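/- Let $d\ge 2$ and $q\ge 2$ be integers. For $p\in[0,1]$ let $P_p$ be the law of a family $J=(J_{\langle xy\rangle})$ of i.i.d. Bernoulli($p$) variables indexed by the nearest-neighbour edges of $\mathbb Z^d$, and let $p_c$ be the supremum of the $p\in[0,1]$ for which, $P_p$-almost surely, the origin is not in an infinite cluster of edges with $J_{\langle xy\rangle}=1$ (the critical probability of bond percolation). Let $S=\{2\pi i/q: 0\le i\le q-1\}$. For a disorder $J$, a finite set $\Lambda\subset\mathbb Z^d$, $\beta>0$ and $\eta\in S^{\mathbb Z^d}$ let $$\mu^{\eta}_{\Lambda,J}(\sigma)=\frac{1}{Z^{\eta}_{\Lambda,J}}\,e^{-\beta H_{\Lambda,J}(\sigma)}\,\mathbf 1[\sigma=\eta \text{ on } \mathbb Z^d\setminus\Lambda],\qquad H_{\Lambda,J}(\sigma)=\sum_{\langle xy\rangle:\ \{x,y\}\cap\Lambda\neq\emptyset}J_{\langle xy\rangle}\bigl(1-\cos(\sigma_x-\sigma_y)\bigr),$$ where $Z^\eta_{\Lambda,J}$ is the normalizing constant. A Gibbs measure for $J$ is a probability measure $\mu$ on $S^{\mathbb Z^d}$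 (with the product $\sigma$-algebra) such that $\mu f=\int\mu(d\eta)\,\mu^\eta_{\Lambda,J}f$ for every finite $\Lambda$ and every function $f:S^{\mathbb Z^d}\to\mathbb R$ depending on finitely many coordinates. Let $\mathcal G_J$ be the set of Gibbs measures for $J$. Let $p\in[0,1]$ with $p>p_c$. Then there is $\beta_0=\beta_0(q,d,p)>0$ such that for every $\beta>\beta_0$, for $P_p$-almost every $J$, we have $|\mathcal G_J|\ge q$. More precisely, for every $\beta>\beta_0$ and $P_p$-almost every $J$ the following also holds. For $b\in S$ consider the measures $\mu^b_{\Lambda_n,J}$ with boundary condition $\eta\equiv b$ in the boxes $\Lambda_n=[-n,n]^d\cap\mathbb Z^d$. For each $b\in S$ this sequence has at least one weak subsequential limit as $n\to\infty$, every such limit belongs to $\mathcal G_J$, and for $a\ne b$ no weak subsequential limit for $a$ is one for $b$. Hence choosing one limit for each $b\in S$ gives $q$ distinct Gibbs measures. -/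

import Mathlib

open MeasureTheory ProbabilityTheory Filter Topology

noncomputable section

namespace DiluteClock

/-! ### The lattice and Bernoulli bond percolation -/

/-- The sites of `ℤ^d`. -/
abbrev Site (d : ℕ) := Fin d → ℤ

/-- The nearest-neighbour graph of `ℤ^d`: `x` and `y` are adjacent when their Euclidean distance
is `1`, written here as `‖x - y‖² = 1`. -/
def lattice (d : ℕ) : SimpleGraph (Site d) where
  Adj x y := ∑ i, (x i - y i) ^ 2 = 1
  symm := ⟨fun x y h => by
    rw [← h]
    exact Finset.sum_congr rfl fun i _ => by ring⟩
  loopless := ⟨fun x h => by simp at h⟩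

/-- The nearest-neighbour edges `⟨xy⟩` of `ℤ^d`. -/
abbrev Edge (d : ℕ) := ↥((lattice d).edgeSet)

/-- A disorder realization `J = (J_e)`, with `J_e ∈ {0, 1}` coded as `false` / `true`. -/
abbrev Disorder (d : ℕ) := Edge d → Bool

/-- The law `P_p` of an i.i.d. family of Bernoulli(`p`) variables indexed by the edges. -/
def disorderLaw (d : ℕ) (p : unitInterval) : Measure (Disorder d) :=
  Measure.infinitePi fun _ : Edge d => bernoulliMeasure true false p

/-- The graph of `J`-open edges. -/
def openGraph {d : ℕ} (J : Disorder d) : SimpleGraph (Site d) where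
  Adj x y := ∃ h : (lattice d).Adj x y, J ⟨s(x, y), h⟩ = true
  symm := ⟨fun x y ⟨h, hJ⟩ => ⟨h.symm, by
    rw [← hJ]
    exact congrArg J (Subtype.ext Sym2.eq_swap)⟩⟩
  loopless := ⟨fun x ⟨h, _⟩ => (lattice d).loopless.irrefl x h⟩

/-- The `J`-open cluster of the site `x`. -/
def cluster {d : ℕ} (J : Disorder d) (x : Site d) : Set (Site d) :=
  {y | (openGraph J).Reachable x y}

/-- The percolation probability: the `P_p`-probability that the origin lies in an infinite
open cluster. -/
def percolationProb (d : ℕ) (p : unitInterval) : ENNReal :=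
  disorderLaw d p {J | (cluster J 0).Infinite}

/-- The critical probability for Bernoulli bond percolation on `ℤ^d`: the supremum of the
`p ∈ [0, 1]` for which the percolation probability vanishes. -/
def criticalProb (d : ℕ) : ℝ :=
  sSup {p : ℝ | ∃ h : p ∈ Set.Icc (0 : ℝ) 1, percolationProb d ⟨p, h⟩ = 0}

/-! ### The dilute clock model -/

/-- Spins: `a : Fin q` stands for the angle `2πa/q`. -/
abbrev Spin (q : ℕ) := Fin q

/-- The angle of a spin. -/
def angle {q : ℕ} (a : Spin q) : ℝ := 2 * Real.pi * (a : ℕ) / q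

/-- Spin configurations on `ℤ^d`, with the product topology and product `σ`-algebra. -/
abbrev Config (d q : ℕ) := Site d → Spin q

/-- The energy `1 - cos (σ_x - σ_y)` of the edge `⟨xy⟩`. -/
def edgeEnergy {d q : ℕ} (σ : Config d q) : Sym2 (Site d) → ℝ :=
  Sym2.lift ⟨fun x y => 1 - Real.cos (angle (σ x) - angle (σ y)), fun x y => by
    show 1 - Real.cos (angle (σ x) - angle (σ y)) = 1 - Real.cos (angle (σ y) - angle (σ x))
    rw [← Real.cos_neg, neg_sub]⟩

theorem neighbours_finite {d : ℕ} (x : Site d) : {y | (lattice d).Adj x y}.Finite := by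
  refine (Set.finite_Icc (x - 1) (x + 1)).subset fun y hy => ?_
  have hy' : ∑ i, (x i - y i) ^ 2 = 1 := hy
  have key : ∀ i, (x i - y i) ^ 2 ≤ 1 := fun i => by
    rw [← hy']
    exact Finset.single_le_sum (f := fun i => (x i - y i) ^ 2) (fun j _ => sq_nonneg _)
      (Finset.mem_univ i)
  refine ⟨fun i => ?_, fun i => ?_⟩ <;>
  · have := abs_le.1 ((sq_le_one_iff_abs_le_one _).1 (key i))
    simp only [Pi.sub_apply, Pi.add_apply, Pi.one_apply]
    linarith [this.1, this.2]

theorem touching_finite {d : ℕ} (Λ : Finset (Site d)) :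
    {e : Edge d | ∃ x ∈ Λ, x ∈ e.1}.Finite := by
  refine Set.Finite.of_finite_image (f := Subtype.val) ?_ Subtype.val_injective.injOn
  refine (Set.Finite.biUnion Λ.finite_toSet
    fun x _ => (neighbours_finite x).image fun y => s(x, y)).subset ?_
  rintro _ ⟨⟨e, he⟩, ⟨x, hx, hxe⟩, rfl⟩
  obtain ⟨y, rfl⟩ := hxe
  exact Set.mem_biUnion hx ⟨y, he, rfl⟩

/-- The nearest-neighbour edges with at least one endpoint in `Λ`. -/
def touching {d : ℕ} (Λ : Finset (Site d)) : Finset (Edge d) := (touching_finite Λ).toFinset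

/-- The Hamiltonian `H_{Λ,J}(σ) = ∑ J_{⟨xy⟩} (1 - cos (σ_x - σ_y))`, the sum being over the
nearest-neighbour edges `⟨xy⟩` with `{x, y} ∩ Λ ≠ ∅`. -/
def hamiltonian {d q : ℕ} (Λ : Finset (Site d)) (J : Disorder d) (σ : Config d q) : ℝ :=
  ∑ e ∈ touching Λ, (if J e then 1 else 0) * edgeEnergy σ e.1

/-- The configuration equal to `ζ` in `Λ` and to `η` outside `Λ`. -/
def glue {d q : ℕ} (Λ : Finset (Site d)) (η : Config d q) (ζ : Λ → Spin q) : Config d q :=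
  fun x => if h : x ∈ Λ then ζ ⟨x, h⟩ else η x

/-- The normalizing constant `Z^η_{Λ,J}`. -/
def partitionFunction {d q : ℕ} (β : ℝ) (J : Disorder d) (Λ : Finset (Site d))
    (η : Config d q) : ℝ :=
  ∑ ζ : Λ → Spin q, Real.exp (-β * hamiltonian Λ J (glue Λ η ζ))

/-- The specification `μ^η_{Λ,J}`: the probability on configurations that gives mass
`exp (-β H_{Λ,J}(σ)) / Z^η_{Λ,J}` to each of the finitely many `σ` that agree with `η`
outside `Λ`. -/
def specMeasure {d q : ℕ} (β : ℝ) (J : Disorder d) (Λ : Finset (Site d)) (η : Config d q) :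
    Measure (Config d q) :=
  ∑ ζ : Λ → Spin q,
    ENNReal.ofReal (Real.exp (-β * hamiltonian Λ J (glue Λ η ζ)) / partitionFunction β J Λ η) •
      Measure.dirac (glue Λ η ζ)

theorem partitionFunction_pos {d q : ℕ} (β : ℝ) (J : Disorder d) (Λ : Finset (Site d))
    (η : Config d q) : 0 < partitionFunction β J Λ η :=
  Finset.sum_pos (fun _ _ => Real.exp_pos _) ⟨fun x => η x, Finset.mem_univ _⟩

instance isProbabilityMeasure_specMeasure {d q : ℕ} (β : ℝ) (J : Disorder d)
    (Λ : Finset (Site d)) (η : Config d q) : IsProbabilityMeasure (specMeasure β J Λ η) := ⟨by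
  have hZ := partitionFunction_pos β J Λ η
  simp only [specMeasure, Measure.coe_finsetSum, Finset.sum_apply, Measure.smul_apply,
    measure_univ, smul_eq_mul, mul_one]
  rw [← ENNReal.ofReal_sum_of_nonneg fun _ _ => div_nonneg (Real.exp_pos _).le hZ.le,
    ← Finset.sum_div]
  change ENNReal.ofReal (partitionFunction β J Λ η / partitionFunction β J Λ η) = 1
  rw [div_self hZ.ne', ENNReal.ofReal_one]⟩

/-- The specification as an element of the space of probability measures. -/
def spec {d q : ℕ} (β : ℝ) (J : Disorder d) (Λ : Finset (Site d)) (η : Config d q) :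
    ProbabilityMeasure (Config d q) :=
  ⟨specMeasure β J Λ η, inferInstance⟩

/-- The set `𝒢_J` of Gibbs measures of the disorder `J` at inverse temperature `β`: the
probabilities `μ` with `μ f = ∫ μ(dη) μ^η_{Λ,J} f` for every finite `Λ` and every local
function `f`. -/
def gibbsMeasures {d : ℕ} (q : ℕ) (β : ℝ) (J : Disorder d) :
    Set (ProbabilityMeasure (Config d q)) :=
  {μ | ∀ (Λ Δ : Finset (Site d)) (f : Config d q → ℝ), DependsOn f (Δ : Set (Site d)) →
    ∫ σ, f σ ∂(μ : Measure (Config d q)) =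
      ∫ η, (∫ σ, f σ ∂(spec β J Λ η : Measure (Config d q))) ∂(μ : Measure (Config d q))}

/-- The box `Λ_n = [-n, n]^d ∩ ℤ^d`. -/
def box (d n : ℕ) : Finset (Site d) := Finset.Icc (fun _ => -(n : ℤ)) (fun _ => (n : ℤ))

/-- The weak limits, as `n → ∞` (possibly along a subsequence), of the specifications in the
boxes `Λ_n` with constant boundary condition `b`. -/
def weakLimits {d q : ℕ} (β : ℝ) (J : Disorder d) (b : Spin q) :
    Set (ProbabilityMeasure (Config d q)) :=
  {ν | ∃ k : ℕ → ℕ, StrictMono k ∧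
    Tendsto (fun n => spec β J (box d (k n)) (fun _ => b)) atTop (𝓝 ν)}

end DiluteClock

end

noncomputable section

namespace DiluteClock

/-! ### Percolation -/

/-! The proof compares the clock model on the `J`-open edges with independent thinning of those
edges.

Write `z` for the relative phase across an edge, a `q`-th root of unity, and let δ be the total
Boltzmann weight of the values `z ≠ 1`. The edge weight splits as `exp (-β (1 - Re z)) = (1 - δ) 1[z
= 1] + ρ(z)`, where ρ lies between 0 and δ and both parts have nonnegative Fourier coefficients.
Expanding the product over edges labels each edge open (factor `1[z = 1]`) or closed (factor ρ), as
in a random-cluster representation.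

Positivity of Fourier coefficients is used twice, in the spirit of Griffiths' inequalities, with
phases measured relative to the boundary spin `b`. By `sum_le_mul_sum_indicator`, a weight of
positive type gives `z = 1` at least a fraction `1/q` of its mass. So, once δ is small, each edge is
open with conditional probability at least `r` given the other labels, and the open edges dominate
Bernoulli(`r`) percolation on the `J`-open edges (`subsetExpectation_mul_sum_le`). By
`sum_mul_boundary_sub_nonneg`, label configurations not joining `x` to the boundary contribute
nonnegatively to `μ(σ_x = b) - μ(σ_x = a)`. Those that do join it force `σ_x = b`. Hence this
difference is at least the probability that the thinned cluster of `x` is infinite, uniformly in the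
volume (`cluster_infinite_le_integral_spec`).

Since `p > p_c`, some `r < 1` has `p r > p_c`. The zero-one law and Fubini then provide, for almost
every `J`, a site `x` where that probability is positive. The bound survives weak limits, and since
the difference changes sign when `a` and `b` are exchanged, a common limit is impossible. Existence
of limits is compactness; that they are Gibbs is consistency of the specification together with its
locality. -/

theorem measurableSet_openGraph_adj {d : ℕ} (x y : Site d) :
    MeasurableSet {J : Disorder d | (openGraph J).Adj x y} := by
  by_cases h : (lattice d).Adj x y
  · have : {J : Disorder d | (openGraph J).Adj x y} =
        (fun J : Disorder d => J ⟨s(x, y), h⟩) ⁻¹' {true} := by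
      ext J
      exact ⟨fun ⟨_, hJ⟩ => hJ, fun hJ => ⟨h, hJ⟩⟩
    rw [this]
    exact measurable_pi_apply _ (measurableSet_singleton _)
  · have : {J : Disorder d | (openGraph J).Adj x y} = ∅ := by
      ext J
      exact ⟨fun ⟨h', _⟩ => h h', fun h' => h'.elim⟩
    rw [this]
    exact MeasurableSet.empty

theorem measurableSet_exists_walk {d : ℕ} (n : ℕ) (x y : Site d) :
    MeasurableSet {J : Disorder d | ∃ w : (openGraph J).Walk x y, w.length = n} := by
  induction n generalizing x with
  | zero =>
    have : {J : Disorder d | ∃ w : (openGraph J).Walk x y, w.length = 0} = {_J | x = y} := by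
      ext J
      exact ⟨fun ⟨w, hw⟩ => SimpleGraph.Walk.eq_of_length_eq_zero hw, by
        rintro rfl; exact ⟨.nil, rfl⟩⟩
    rw [this]
    exact MeasurableSet.const _
  | succ n ih =>
    have : {J : Disorder d | ∃ w : (openGraph J).Walk x y, w.length = n + 1} =
        ⋃ z : Site d, {J | (openGraph J).Adj x z} ∩
          {J | ∃ w : (openGraph J).Walk z y, w.length = n} := by
      ext J
      simp only [Set.mem_iUnion, Set.mem_inter_iff, Set.mem_ofPred_eq]
      constructor
      · rintro ⟨w, hw⟩
        cases w with
        | nil => simp at hw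
        | cons h w' => exact ⟨_, h, w', by simpa using hw⟩
      · rintro ⟨z, h, w, hw⟩
        exact ⟨.cons h w, by simp [hw]⟩
    rw [this]
    exact MeasurableSet.iUnion fun z => (measurableSet_openGraph_adj x z).inter (ih z)

theorem measurableSet_reachable {d : ℕ} (x y : Site d) :
    MeasurableSet {J : Disorder d | (openGraph J).Reachable x y} := by
  have : {J : Disorder d | (openGraph J).Reachable x y} =
      ⋃ n : ℕ, {J | ∃ w : (openGraph J).Walk x y, w.length = n} := by
    ext J
    simp only [Set.mem_iUnion, Set.mem_ofPred_eq]
    exact ⟨fun ⟨w⟩ => ⟨_, w, rfl⟩, fun ⟨_, w, _⟩ => ⟨w⟩⟩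
  rw [this]
  exact MeasurableSet.iUnion fun n => measurableSet_exists_walk n x y

theorem measurableSet_cluster_infinite {d : ℕ} (x : Site d) :
    MeasurableSet {J : Disorder d | (cluster J x).Infinite} := by
  have : {J : Disorder d | (cluster J x).Infinite} =
      ⋂ Λ : Finset (Site d), ⋃ y : {y // y ∉ Λ}, {J | (openGraph J).Reachable x y} := by
    ext J
    simp only [Set.mem_iInter, Set.mem_iUnion, Set.mem_ofPred_eq]
    constructor
    · intro h Λ
      obtain ⟨y, hy, hyΛ⟩ := h.exists_notMem_finset Λ
      exact ⟨⟨y, hyΛ⟩, hy⟩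
    · intro h hfin
      obtain ⟨⟨y, hy⟩, hxy⟩ := h hfin.toFinset
      exact hy (hfin.mem_toFinset.2 hxy)
  rw [this]
  exact MeasurableSet.iInter fun Λ => MeasurableSet.iUnion fun y => measurableSet_reachable x y

/-- The event that there is an infinite open cluster. -/
def percolates (d : ℕ) : Set (Disorder d) := {J | ∃ x, (cluster J x).Infinite}

theorem measurableSet_percolates (d : ℕ) : MeasurableSet (percolates d) := by
  have : percolates d = ⋃ x, {J | (cluster J x).Infinite} := by
    ext J; simp [percolates]
  rw [this]
  exact MeasurableSet.iUnion measurableSet_cluster_infinite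

theorem reachable_mono {d : ℕ} {J J' : Disorder d} (h : ∀ e, J e = true → J' e = true)
    {x y : Site d} (hxy : (openGraph J).Reachable x y) : (openGraph J').Reachable x y := by
  have hle : openGraph J ≤ openGraph J' := by
    rintro a b ⟨ha, hJ⟩
    exact ⟨ha, h _ hJ⟩
  exact hxy.mono hle

/-- The disorder with the edges of `F` closed. -/
def closeEdges {d : ℕ} (F : Set (Edge d)) (J : Disorder d) : Disorder d :=
  open Classical in fun e => if e ∈ F then false else J e

/-- Closing finitely many edges breaks a cluster into finitely many pieces, each containing the
starting site or an endpoint of a closed edge. If all the pieces are finite, so is the cluster. -/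
theorem percolates_closeEdges {d : ℕ} {F : Set (Edge d)} (hF : F.Finite) (J : Disorder d) :
    closeEdges F J ∈ percolates d ↔ J ∈ percolates d := by
  constructor
  · rintro ⟨x, hx⟩
    refine ⟨x, hx.mono fun y hy => reachable_mono (fun e he => ?_) hy⟩
    by_contra h
    simp [closeEdges, h] at he
  · rintro ⟨x, hx⟩
    by_contra hcon
    have hfin : ∀ v, (cluster (closeEdges F J) v).Finite := fun v => by
      by_contra h
      exact hcon ⟨v, h⟩
    set V : Set (Site d) := insert x (⋃ e ∈ F, {v | v ∈ e.1}) with hV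
    have hVfin : V.Finite := by
      refine (hF.biUnion fun e _ => ?_).insert x
      obtain ⟨e, he⟩ := e
      induction e using Sym2.ind with
      | _ a b =>
        refine (Set.toFinite {a, b}).subset fun v hv => ?_
        simpa using hv
    refine hx ((hVfin.biUnion fun v _ => hfin v).subset fun y hy => ?_)
    have hy' : Relation.ReflTransGen (openGraph J).Adj x y :=
      (SimpleGraph.reachable_iff_reflTransGen x y).1 hy
    induction hy' with
    | refl => exact Set.mem_biUnion (Set.mem_insert _ _) (SimpleGraph.Reachable.refl x)
    | @tail y z hxy hyz ih =>
      obtain ⟨h, hJ⟩ := hyz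
      -- When the path crosses an edge of `F`, restart from its far endpoint, which belongs to `V`.
      by_cases hmem : (⟨s(y, z), h⟩ : Edge d) ∈ F
      · refine Set.mem_biUnion (x := z) (Or.inr ?_) (SimpleGraph.Reachable.refl z)
        exact Set.mem_biUnion hmem (Sym2.mem_mk_right y z)
      · obtain ⟨v, hv, hvy⟩ := Set.mem_iUnion₂.1
          (ih ((SimpleGraph.reachable_iff_reflTransGen x y).2 hxy))
        refine Set.mem_biUnion hv (SimpleGraph.Reachable.trans hvy ?_)
        exact SimpleGraph.Adj.reachable ⟨h, by simpa [closeEdges, hmem] using hJ⟩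

instance {d : ℕ} (p : unitInterval) : IsProbabilityMeasure (disorderLaw d p) := by
  unfold disorderLaw; infer_instance

/-- Kolmogorov's zero-one law for the existence of an infinite cluster. -/
theorem disorderLaw_percolates_eq_zero_or_one (d : ℕ) (p : unitInterval) :
    disorderLaw d p (percolates d) = 0 ∨ disorderLaw d p (percolates d) = 1 := by
  let s : Edge d → MeasurableSpace (Disorder d) := fun e =>
    MeasurableSpace.comap (fun J => J e) inferInstance
  have hind : iIndep s (disorderLaw d p) := by
    exact iIndepFun_infinitePi (P := fun _ : Edge d => bernoulliMeasure true false p)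
      (X := fun _ b => b) (fun _ => measurable_id)
  refine measure_zero_or_one_of_measurableSet_limsup (p := Set.Finite) (f := cofinite)
    (ns := fun F : Finset (Edge d) => (F : Set (Edge d)))
    (fun e => (measurable_pi_apply e).comap_le) hind (fun t ht => ht.compl_mem_cofinite)
    ?_ (fun F => F.finite_toSet) (fun e => ⟨{e}, by simp⟩) ?_
  · intro F G
    classical
    exact ⟨F ∪ G, by simp, by simp⟩
  · rw [limsup_eq_iInf_iSup, MeasurableSpace.measurableSet_iInf]
    intro t
    rw [MeasurableSpace.measurableSet_iInf]
    intro ht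
    -- The event is unchanged by closing the finitely many edges off `t`, so it depends only on the
    -- edges in `t`.
    have : percolates d = closeEdges tᶜ ⁻¹' percolates d := by
      ext J
      exact (percolates_closeEdges ht J).symm
    rw [this]
    suffices h : @Measurable _ _ (⨆ e ∈ t, s e) _ (closeEdges tᶜ) from
      h (measurableSet_percolates d)
    refine @measurable_pi_lambda _ _ _ (⨆ e ∈ t, s e) _ _ fun e => ?_
    by_cases he : e ∈ t
    · have : (fun J : Disorder d => closeEdges tᶜ J e) = fun J => J e := by
        funext J; simp [closeEdges, he]
      rw [this]
      exact Measurable.mono (ma := s e) (comap_measurable fun J : Disorder d => J e)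
        (le_iSup₂_of_le (f := fun e (_ : e ∈ t) => s e) e he le_rfl) le_rfl
    · have : (fun J : Disorder d => closeEdges tᶜ J e) = fun J => false := by
        funext J; simp [closeEdges, he]
      rw [this]
      exact @measurable_const _ _ _ (⨆ e ∈ t, s e) _

theorem criticalProb_nonneg (d : ℕ) : 0 ≤ criticalProb d :=
  Real.sSup_nonneg fun _ ⟨h, _⟩ => h.1

/-- Above the supremum the percolation probability is nonzero, and the zero-one law raises the
probability of an infinite cluster somewhere to one. -/
theorem ae_percolates_of_criticalProb_lt {d : ℕ} {p : unitInterval}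
    (hp : criticalProb d < p) : ∀ᵐ J ∂disorderLaw d p, J ∈ percolates d := by
  have hpos : percolationProb d p ≠ 0 := fun h => by
    have hmem : (p : ℝ) ∈ {p : ℝ | ∃ h : p ∈ Set.Icc (0 : ℝ) 1, percolationProb d ⟨p, h⟩ = 0} :=
      ⟨p.2, h⟩
    refine absurd (le_csSup ⟨1, ?_⟩ hmem) (not_le.2 hp)
    rintro _ ⟨h, _⟩
    exact h.2
  have h1 : disorderLaw d p (percolates d) = 1 := by
    refine (disorderLaw_percolates_eq_zero_or_one d p).resolve_left fun h0 => hpos ?_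
    exact measure_mono_null
      (fun J (hJ : (cluster J 0).Infinite) => (⟨0, hJ⟩ : J ∈ percolates d)) h0
  exact (prob_compl_eq_zero_iff (measurableSet_percolates d)).2 h1

/-- The disorder whose open edges are open in both arguments. -/
def thin {d : ℕ} (J ω : Disorder d) : Disorder d := fun e => J e && ω e

theorem measurable_thin {d : ℕ} :
    Measurable fun x : Disorder d × Disorder d => thin x.1 x.2 := by
  refine measurable_pi_lambda _ fun e => ?_
  have : Measurable fun b : Bool × Bool => (b.1 && b.2) := measurable_of_countable _
  have hpair : Measurable fun x : Disorder d × Disorder d => (x.1 e, x.2 e) := by fun_prop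
  exact this.comp hpair

theorem lintegral_bernoulliMeasure_and (p r : unitInterval) (t : Set Bool) :
    ∫⁻ j, bernoulliMeasure true false r {w | (j && w) ∈ t} ∂bernoulliMeasure true false p =
      bernoulliMeasure true false (p * r) t := by
  classical
  have hs : ∀ s : Set Bool, MeasurableSet s := fun s => s.toFinite.measurableSet
  rw [bernoulliMeasure_def (p := p), lintegral_add_measure, lintegral_smul_measure,
    lintegral_smul_measure, lintegral_dirac, lintegral_dirac]
  have hsum : ENNReal.ofNNReal (unitInterval.toNNReal p) +
      ENNReal.ofNNReal (unitInterval.toNNReal (unitInterval.symm p)) = 1 := by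
    rw [← ENNReal.coe_add, unitInterval.toNNReal_add_toNNReal_symm, ENNReal.coe_one]
  rw [bernoulliMeasure_apply _ (hs _), bernoulliMeasure_apply _ (hs _),
    bernoulliMeasure_apply _ (hs _)]
  by_cases h1 : true ∈ t <;> by_cases h2 : false ∈ t <;> simp [h1, h2]
  · exact hsum
  · rw [ENNReal.smul_def, smul_eq_mul, ← ENNReal.coe_mul]
    exact congrArg _ (NNReal.eq (by simp))
  · rw [ENNReal.smul_def, smul_eq_mul, ← ENNReal.coe_mul, ← ENNReal.coe_add]
    refine congrArg _ (NNReal.eq ?_)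
    push_cast
    simp
    ring

/-- Both laws are products over edges, so it suffices to compare cylinders, where the integral
factors into the one-edge identity `lintegral_bernoulliMeasure_and`. -/
theorem map_thin_disorderLaw (d : ℕ) (p r : unitInterval) :
    ((disorderLaw d p).prod (disorderLaw d r)).map (fun x => thin x.1 x.2) =
      disorderLaw d (p * r) := by
  refine Measure.eq_infinitePi _ fun s t ht => ?_
  have hm : MeasurableSet (Set.pi (s : Set (Edge d)) t) :=
    MeasurableSet.pi s.countable_toSet fun e _ => ht e
  rw [Measure.map_apply measurable_thin hm, Measure.prod_apply (measurable_thin hm)]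
  have hinner : ∀ J : Disorder d,
      disorderLaw d r (Prod.mk J ⁻¹' ((fun x : Disorder d × Disorder d => thin x.1 x.2) ⁻¹'
        Set.pi s t)) =
      ∏ e ∈ s, bernoulliMeasure true false r {w | (J e && w) ∈ t e} := fun J => by
    rw [← Measure.infinitePi_pi (μ := fun _ : Edge d => bernoulliMeasure true false r)
      (t := fun e => {w | (J e && w) ∈ t e})
      fun e _ => (Set.toFinite {w | (J e && w) ∈ t e}).measurableSet]
    rfl
  simp_rw [hinner, ← lintegral_bernoulliMeasure_and]
  unfold disorderLaw
  rw [lintegral_prod_eq_prod_lintegral_of_indepFun s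
    (fun e (J : Disorder d) => bernoulliMeasure true false r {w | (J e && w) ∈ t e})
    (iIndepFun_infinitePi (P := fun _ : Edge d => bernoulliMeasure true false p)
      (X := fun e j => bernoulliMeasure true false r {w | (j && w) ∈ t e})
      fun _ => measurable_of_countable _)
    fun e => (measurable_of_countable fun j : Bool =>
      bernoulliMeasure true false r {w | (j && w) ∈ t e}).comp (measurable_pi_apply e)]
  refine Finset.prod_congr rfl fun e _ => ?_
  exact (measurePreserving_eval_infinitePi
    (fun _ : Edge d => bernoulliMeasure true false p) e).lintegral_comp
      (measurable_of_countable fun j : Bool =>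
        bernoulliMeasure true false r {w | (j && w) ∈ t e})

/-- Above the critical probability, almost every disorder still percolates, with positive
probability from some site, after an independent thinning of its open edges. -/
theorem exists_thinning_ae_percolates {d : ℕ} {p : unitInterval} (hp : criticalProb d < p) :
    ∃ r : unitInterval, (r : ℝ) < 1 ∧ ∀ᵐ J ∂disorderLaw d p,
      ∃ x, disorderLaw d r {ω | (cluster (thin J ω) x).Infinite} ≠ 0 := by
  have hp0 : (0 : ℝ) < p := (criticalProb_nonneg d).trans_lt hp
  -- Any `r` strictly between `p_c / p` and 1 keeps the thinned density `p r` supercritical.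
  obtain ⟨r, hr, hr1⟩ := exists_between ((div_lt_one hp0).2 hp)
  have hr0 : 0 ≤ r := (div_nonneg (criticalProb_nonneg d) hp0.le).trans hr.le
  refine ⟨⟨r, hr0, hr1.le⟩, hr1, ?_⟩
  set r' : unitInterval := ⟨r, hr0, hr1.le⟩
  have hpr : criticalProb d < (p * r' : unitInterval) := by
    rw [div_lt_iff₀ hp0] at hr
    calc criticalProb d < r * p := hr
      _ = _ := mul_comm _ _
  have h := ae_percolates_of_criticalProb_lt hpr
  rw [← map_thin_disorderLaw] at h
  filter_upwards [Measure.ae_ae_of_ae_prod (ae_of_ae_map measurable_thin.aemeasurable h)]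
    with J hJ
  by_contra! hcon
  -- There are only countably many sites, so if every site had probability zero, almost surely no
  -- thinned cluster would be infinite.
  have hnull : ∀ᵐ ω ∂disorderLaw d r', ∀ x, ¬ (cluster (thin J ω) x).Infinite :=
    ae_all_iff.2 fun x => by
      rw [ae_iff]
      simpa using hcon x
  obtain ⟨ω, ⟨x, hx⟩, hω⟩ := (hJ.and hnull).exists
  exact hω x hx

/-! ### Consistency of the specification and its weak limits -/

theorem integral_spec {d q : ℕ} (β : ℝ) (J : Disorder d) (Λ : Finset (Site d)) (η : Config d q)
    (f : Config d q → ℝ) :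
    ∫ σ, f σ ∂(spec β J Λ η : Measure (Config d q)) =
      ∑ ζ : Λ → Spin q, Real.exp (-β * hamiltonian Λ J (glue Λ η ζ)) / partitionFunction β J Λ η *
        f (glue Λ η ζ) := by
  change ∫ σ, f σ ∂(specMeasure β J Λ η) = _
  unfold specMeasure
  have hfin : ∀ ζ : Λ → Spin q, Integrable f (Measure.dirac (glue Λ η ζ)) := fun ζ =>
    integrable_dirac (by simp)
  rw [integral_finsetSum_measure fun ζ _ => (hfin ζ).smul_measure ENNReal.ofReal_ne_top]
  refine Finset.sum_congr rfl fun ζ _ => ?_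
  rw [integral_smul_measure, integral_dirac, ENNReal.toReal_ofReal, smul_eq_mul]
  exact div_nonneg (Real.exp_pos _).le (partitionFunction_pos β J Λ η).le

theorem edgeEnergy_congr {d q : ℕ} {σ τ : Config d q} {e : Sym2 (Site d)}
    (h : ∀ x ∈ e, σ x = τ x) : edgeEnergy σ e = edgeEnergy τ e := by
  induction e using Sym2.ind with
  | _ x y =>
    simp only [edgeEnergy, Sym2.lift_mk, h x (Sym2.mem_mk_left x y), h y (Sym2.mem_mk_right x y)]

theorem mem_touching {d : ℕ} {Λ : Finset (Site d)} {e : Edge d} :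
    e ∈ touching Λ ↔ ∃ x ∈ Λ, x ∈ e.1 := by
  simp [touching]

theorem glue_of_notMem {d q : ℕ} {Λ : Finset (Site d)} (η : Config d q) (ζ : Λ → Spin q)
    {x : Site d} (h : x ∉ Λ) : glue Λ η ζ x = η x := by
  simp [glue, h]

theorem glue_congr {d q : ℕ} {Λ : Finset (Site d)} {η η' : Config d q}
    (h : ∀ x ∉ Λ, η x = η' x) (ζ : Λ → Spin q) : glue Λ η ζ = glue Λ η' ζ := by
  funext x
  by_cases hx : x ∈ Λ
  · simp [glue, hx]
  · simp [glue, hx, h x hx]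

/-- Two configurations that agree off `Λ` have the same energy difference in `Λ` and in any larger
volume. -/
theorem hamiltonian_add_hamiltonian {d q : ℕ} {Λ M : Finset (Site d)} (hΛM : Λ ⊆ M)
    (J : Disorder d) {σ τ : Config d q} (h : ∀ x ∉ Λ, σ x = τ x) :
    hamiltonian M J τ + hamiltonian Λ J σ = hamiltonian M J σ + hamiltonian Λ J τ := by
  classical
  have hsub : touching Λ ⊆ touching M := fun e he => by
    obtain ⟨x, hx, hxe⟩ := mem_touching.1 he
    exact mem_touching.2 ⟨x, hΛM hx, hxe⟩
  have hoff : ∑ e ∈ touching M \ touching Λ, (if J e then 1 else 0) * edgeEnergy σ e.1 =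
      ∑ e ∈ touching M \ touching Λ, (if J e then 1 else 0) * edgeEnergy τ e.1 := by
    refine Finset.sum_congr rfl fun e he => ?_
    rw [edgeEnergy_congr fun x hx => h x fun hxΛ => ?_]
    exact (Finset.mem_sdiff.1 he).2 (mem_touching.2 ⟨x, hxΛ, hx⟩)
  unfold hamiltonian
  rw [← Finset.sum_sdiff hsub, ← Finset.sum_sdiff hsub, hoff]
  ring

/-- Resampling the spins in `Λ` is reversible for the measure in `M`. The involution `Φ` exchanges
the old and the resampled spins and preserves the joint weight, because `Z_Λ` sees only the spins
off `Λ` and energy differences agree in the two volumes. -/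
theorem integral_integral_spec {d q : ℕ} (β : ℝ) (J : Disorder d) {Λ M : Finset (Site d)}
    (hΛM : Λ ⊆ M) (η : Config d q) (f : Config d q → ℝ) :
    ∫ σ, (∫ τ, f τ ∂(spec β J Λ σ : Measure (Config d q)))
        ∂(spec β J M η : Measure (Config d q)) =
      ∫ σ, f σ ∂(spec β J M η : Measure (Config d q)) := by
  simp_rw [integral_spec]
  set A : (M → Spin q) → ℝ := fun ζ =>
    Real.exp (-β * hamiltonian M J (glue M η ζ)) / partitionFunction β J M η
  set B : (M → Spin q) → (Λ → Spin q) → ℝ := fun ζ ξ =>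
    Real.exp (-β * hamiltonian Λ J (glue Λ (glue M η ζ) ξ)) /
      partitionFunction β J Λ (glue M η ζ)
  change ∑ ζ, A ζ * ∑ ξ, B ζ ξ * f (glue Λ (glue M η ζ) ξ) = ∑ ζ, A ζ * f (glue M η ζ)
  have hB : ∀ ζ, ∑ ξ, B ζ ξ = 1 := fun ζ => by
    simp only [B]
    rw [← Finset.sum_div]
    exact div_self (partitionFunction_pos β J Λ _).ne'
  let Φ : (M → Spin q) × (Λ → Spin q) → (M → Spin q) × (Λ → Spin q) := fun p =>
    (fun x => if h : x.1 ∈ Λ then p.2 ⟨x.1, h⟩ else p.1 x, fun x => p.1 ⟨x.1, hΛM x.2⟩)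
  have hΦ : Function.Involutive Φ := fun p => by
    refine Prod.ext (funext fun x => ?_) (funext fun x => ?_)
    · by_cases h : x.1 ∈ Λ <;> simp [Φ, h]
    · simp [Φ]
  have hΦ1 : ∀ p, glue M η (Φ p).1 = glue Λ (glue M η p.1) p.2 := fun p => by
    funext x
    by_cases hx : x ∈ Λ
    · simp [glue, Φ, hx, hΛM hx]
    · by_cases hM : x ∈ M <;> simp [glue, Φ, hx, hM]
  have hΦ2 : ∀ p, glue Λ (glue M η (Φ p).1) (Φ p).2 = glue M η p.1 := fun p => by
    have := hΦ1 (Φ p)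
    rw [hΦ p] at this
    exact this.symm
  have hsymm : ∀ p, A (Φ p).1 * B (Φ p).1 (Φ p).2 = A p.1 * B p.1 p.2 := fun p => by
    have hZ : partitionFunction β J Λ (glue M η (Φ p).1) =
        partitionFunction β J Λ (glue M η p.1) := by
      unfold partitionFunction
      refine Finset.sum_congr rfl fun ξ _ => ?_
      rw [hΦ1, glue_congr fun x hx => glue_of_notMem (glue M η p.1) p.2 hx]
    have hH := hamiltonian_add_hamiltonian hΛM J (σ := glue M η p.1)
      (τ := glue Λ (glue M η p.1) p.2) fun x hx => (glue_of_notMem _ _ hx).symm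
    simp only [A, B]
    rw [hZ, hΦ2, hΦ1, div_mul_div_comm, div_mul_div_comm, ← Real.exp_add, ← Real.exp_add,
      ← mul_add, ← mul_add, hH]
  calc ∑ ζ, A ζ * ∑ ξ, B ζ ξ * f (glue Λ (glue M η ζ) ξ)
      = ∑ p : (M → Spin q) × (Λ → Spin q),
          A p.1 * B p.1 p.2 * f (glue Λ (glue M η p.1) p.2) := by
        rw [Fintype.sum_prod_type]
        simp_rw [Finset.mul_sum, mul_assoc]
    _ = ∑ p : (M → Spin q) × (Λ → Spin q), A p.1 * B p.1 p.2 * f (glue M η p.1) := by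
        rw [← Equiv.sum_comp hΦ.toPerm]
        refine Finset.sum_congr rfl fun p _ => ?_
        rw [Function.Involutive.coe_toPerm, hΦ2, hsymm]
    _ = ∑ ζ, A ζ * f (glue M η ζ) := by
        rw [Fintype.sum_prod_type]
        refine Finset.sum_congr rfl fun ζ _ => ?_
        calc ∑ ξ, A ζ * B ζ ξ * f (glue M η ζ) = A ζ * f (glue M η ζ) * ∑ ξ, B ζ ξ := by
              rw [Finset.mul_sum]
              exact Finset.sum_congr rfl fun ξ _ => by ring
          _ = _ := by rw [hB, mul_one]

theorem continuous_of_dependsOn {d q : ℕ} {f : Config d q → ℝ} {D : Set (Site d)}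
    (hD : D.Finite) (hf : DependsOn f D) : Continuous f := by
  have := hD.to_subtype
  obtain ⟨g, rfl⟩ := dependsOn_iff_exists_comp.1 hf
  exact continuous_of_discreteTopology.comp (continuous_pi fun x => continuous_apply x.1)

/-- The interaction has finite range, so the kernel maps local functions to local, hence continuous,
functions. This lets the Gibbs equation pass to weak limits. -/
theorem dependsOn_integral_spec {d q : ℕ} (β : ℝ) (J : Disorder d) (Λ : Finset (Site d))
    {f : Config d q → ℝ} {D : Set (Site d)} (hf : DependsOn f D) :
    DependsOn (fun η : Config d q => ∫ σ, f σ ∂(spec β J Λ η : Measure (Config d q)))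
      (D ∪ ⋃ e ∈ touching Λ, {x | x ∈ e.1}) := by
  intro η η' h
  have hglue : ∀ ζ : Λ → Spin q, ∀ x ∈ D ∪ ⋃ e ∈ touching Λ, {x | x ∈ e.1},
      glue Λ η ζ x = glue Λ η' ζ x := fun ζ x hx => by
    by_cases hxΛ : x ∈ Λ <;> simp [glue, hxΛ, h x hx]
  have hH : ∀ ζ : Λ → Spin q,
      hamiltonian Λ J (glue Λ η ζ) = hamiltonian Λ J (glue Λ η' ζ) := fun ζ =>
    Finset.sum_congr rfl fun e he => by
      rw [edgeEnergy_congr fun x hx => hglue ζ x (Or.inr (Set.mem_biUnion he hx))]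
  have hZ : partitionFunction β J Λ η = partitionFunction β J Λ η' := by
    unfold partitionFunction
    simp_rw [hH]
  simp only [integral_spec, hZ, hH]
  refine Finset.sum_congr rfl fun ζ _ => ?_
  rw [hf fun x hx => hglue ζ x (Or.inl hx)]

theorem finite_sites_touching {d : ℕ} (Λ : Finset (Site d)) :
    (⋃ e ∈ touching Λ, {x | x ∈ e.1}).Finite := by
  refine (touching Λ).finite_toSet.biUnion fun e _ => ?_
  obtain ⟨e, he⟩ := e
  induction e using Sym2.ind with
  | _ a b =>
    refine (Set.toFinite {a, b}).subset fun v hv => ?_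
    simpa using hv

theorem tendsto_integral_of_continuous {d q : ℕ} {μ : ℕ → ProbabilityMeasure (Config d q)}
    {ν : ProbabilityMeasure (Config d q)} (h : Tendsto μ atTop (𝓝 ν)) {f : Config d q → ℝ}
    (hf : Continuous f) :
    Tendsto (fun n => ∫ σ, f σ ∂(μ n : Measure (Config d q))) atTop
      (𝓝 (∫ σ, f σ ∂(ν : Measure (Config d q)))) :=
  ProbabilityMeasure.tendsto_iff_forall_integral_tendsto.1 h
    (BoundedContinuousFunction.mkOfCompact ⟨f, hf⟩)

theorem eventually_subset_box {d : ℕ} (Λ : Finset (Site d)) :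
    ∀ᶠ n in atTop, Λ ⊆ box d n := by
  have : ∀ x : Site d, ∀ᶠ n : ℕ in atTop, x ∈ box d n := fun x => by
    have h : ∀ i, ∀ᶠ n : ℕ in atTop, |x i| ≤ (n : ℤ) := fun i =>
      tendsto_natCast_atTop_atTop.eventually_ge_atTop _
    filter_upwards [eventually_all.2 h] with n hn
    exact Finset.mem_Icc.2 ⟨fun i => (abs_le.1 (hn i)).1, fun i => (abs_le.1 (hn i)).2⟩
  have h := (Finset.eventually_all Λ (p := fun x n => x ∈ box d n)).2 fun x _ => this x
  exact h.mono fun n hn x hx => hn x hx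

theorem weakLimits_subset_gibbsMeasures {d q : ℕ} (β : ℝ) (J : Disorder d) (b : Spin q) :
    weakLimits β J b ⊆ gibbsMeasures q β J := by
  rintro ν ⟨k, hk, hν⟩ Λ Δ f hf
  have h1 := tendsto_integral_of_continuous hν (continuous_of_dependsOn Δ.finite_toSet hf)
  have h2 := tendsto_integral_of_continuous hν (continuous_of_dependsOn
    (Δ.finite_toSet.union (finite_sites_touching Λ)) (dependsOn_integral_spec β J Λ hf))
  refine tendsto_nhds_unique h1 (h2.congr' ?_)
  filter_upwards [hk.tendsto_atTop.eventually (eventually_subset_box Λ)] with n hn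
  exact integral_integral_spec β J hn _ f

theorem weakLimits_nonempty {d q : ℕ} (β : ℝ) (J : Disorder d) (b : Spin q) :
    (weakLimits β J b).Nonempty := by
  obtain ⟨ν, k, hk, hν⟩ := CompactSpace.tendsto_subseq
    fun n => spec β J (box d n) (fun _ => b)
  exact ⟨ν, k, hk, hν⟩

/-! ### Roots of unity -/

/-- The primitive root of unity `exp (2πi / q)`. -/
def root (q : ℕ) : ℂ := Complex.exp (2 * Real.pi * Complex.I / q)

theorem isPrimitiveRoot_root {q : ℕ} (hq : q ≠ 0) : IsPrimitiveRoot (root q) q :=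
  Complex.isPrimitiveRoot_exp q hq

theorem root_ne_zero (q : ℕ) : root q ≠ 0 := Complex.exp_ne_zero _

theorem root_pow_eq_exp (q j : ℕ) :
    root q ^ j = Complex.exp ((2 * Real.pi * j / q : ℝ) * Complex.I) := by
  rw [root, ← Complex.exp_nat_mul]
  congr 1
  push_cast
  ring

theorem norm_root_pow (q j : ℕ) : ‖root q ^ j‖ = 1 := by
  rw [root_pow_eq_exp, Complex.norm_exp_ofReal_mul_I]

theorem inv_re_of_norm_eq_one {z : ℂ} (hz : ‖z‖ = 1) : z⁻¹.re = z.re := by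
  rw [Complex.inv_def, Complex.normSq_eq_norm_sq, hz]
  simp

theorem add_inv_of_norm_eq_one {z : ℂ} (hz : ‖z‖ = 1) : z + z⁻¹ = (2 * z.re : ℝ) := by
  have : z⁻¹ = starRingEnd ℂ z := by
    rw [Complex.inv_def, Complex.normSq_eq_norm_sq, hz]
    simp
  rw [this, Complex.add_conj]

theorem re_le_one_of_norm_eq_one {z : ℂ} (hz : ‖z‖ = 1) : |z.re| ≤ 1 :=
  hz ▸ Complex.abs_re_le_norm z

theorem eq_one_iff_re_eq_one {z : ℂ} (hz : ‖z‖ = 1) : z = 1 ↔ z.re = 1 := by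
  constructor
  · rintro rfl; simp
  · intro h
    have h2 : z.re * z.re + z.im * z.im = 1 := by
      rw [← Complex.normSq_apply, Complex.normSq_eq_norm_sq, hz, one_pow]
    rw [h] at h2
    exact Complex.ext h (by simpa using h2)

theorem geom_sum_of_pow_eq_one {q : ℕ} {z : ℂ} (hz : z ^ q = 1) :
    ∑ k ∈ Finset.range q, z ^ k = if z = 1 then (q : ℂ) else 0 := by
  split_ifs with h
  · simp [h]
  · have := mul_geom_sum z q
    rw [hz, sub_self, mul_eq_zero] at this
    exact this.resolve_left (sub_ne_zero.2 h)

/-- The total Boltzmann weight of the nonzero spin differences. -/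
def disagreementWeight (q : ℕ) (β : ℝ) : ℝ :=
  ∑ j ∈ Finset.Ico 1 q, Real.exp (-β * (1 - (root q ^ j).re))

theorem disagreementWeight_nonneg (q : ℕ) (β : ℝ) : 0 ≤ disagreementWeight q β :=
  Finset.sum_nonneg fun _ _ => (Real.exp_pos _).le

theorem tendsto_disagreementWeight (q : ℕ) :
    Tendsto (disagreementWeight q) atTop (𝓝 0) := by
  rw [← Finset.sum_const_zero (s := Finset.Ico 1 q)]
  refine tendsto_finsetSum _ fun j hj => ?_
  rw [Finset.mem_Ico] at hj
  have hc : 0 < 1 - (root q ^ j).re := by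
    have h1 := (abs_le.1 (re_le_one_of_norm_eq_one (norm_root_pow q j))).2
    have h2 : (root q ^ j).re ≠ 1 := fun h =>
      (isPrimitiveRoot_root (q := q) (by omega)).pow_ne_one_of_pos_of_lt (by omega) hj.2
        ((eq_one_iff_re_eq_one (norm_root_pow q j)).2 h)
    exact sub_pos.2 (lt_of_le_of_ne h1 h2)
  exact Real.tendsto_exp_atBot.comp (tendsto_neg_atTop_atBot.atBot_mul_const hc)

theorem sum_ite_root_pow {q : ℕ} (hq : q ≠ 0) {z : ℂ} (hz : z ^ q = 1) (g : ℂ → ℝ) :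
    ∑ j ∈ Finset.Ico 1 q, g (root q ^ j) * (if z = root q ^ j then 1 else 0) =
      if z = 1 then 0 else g z := by
  have hroot := isPrimitiveRoot_root hq
  split_ifs with h
  · refine Finset.sum_eq_zero fun j hj => ?_
    rw [Finset.mem_Ico] at hj
    rw [if_neg, mul_zero]
    rw [h]
    exact (hroot.pow_ne_one_of_pos_of_lt (by omega) hj.2).symm
  · have : NeZero q := ⟨hq⟩
    obtain ⟨i, hi, rfl⟩ := hroot.eq_pow_of_pow_eq_one hz
    have hi0 : 1 ≤ i := by
      rcases Nat.eq_zero_or_pos i with rfl | h0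
      · simp at h
      · exact h0
    rw [Finset.sum_eq_single_of_mem i (Finset.mem_Ico.2 ⟨hi0, hi⟩)]
    · simp
    · intro j hj hji
      rw [if_neg, mul_zero]
      intro heq
      exact hji (hroot.pow_inj (Finset.mem_Ico.1 hj).2 hi heq.symm)

/-- The part of the Boltzmann weight `exp (-β (1 - Re z))` left once as much as possible of the
weight of `z = 1` is removed while keeping nonnegative Fourier coefficients. -/
def residualWeight (q : ℕ) (β : ℝ) (z : ℂ) : ℝ :=
  Real.exp (-β * (1 - z.re)) - (1 - disagreementWeight q β) * (if z = 1 then 1 else 0)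

theorem residualWeight_nonneg {q : ℕ} (β : ℝ) (z : ℂ) : 0 ≤ residualWeight q β z := by
  unfold residualWeight
  split_ifs with h
  · simp [h, disagreementWeight_nonneg]
  · simpa using (Real.exp_pos _).le

/-- There is equality at `z = 1`; for any other root of unity the weight is one of the summands of
`disagreementWeight`. -/
theorem residualWeight_le {q : ℕ} (hq : q ≠ 0) (β : ℝ) {z : ℂ} (hz : z ^ q = 1) :
    residualWeight q β z ≤ disagreementWeight q β := by
  unfold residualWeight
  split_ifs with h
  · simp [h]
  · have := sum_ite_root_pow hq hz fun z => Real.exp (-β * (1 - z.re))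
    rw [if_neg h] at this
    rw [mul_zero, sub_zero, ← this]
    refine Finset.sum_le_sum fun j _ => ?_
    split_ifs
    · rw [mul_one]
    · rw [mul_zero]; exact (Real.exp_pos _).le

/-- Fourier inversion on the `q`-th roots of unity. Symmetrizing in `w` and `w⁻¹` makes the
coefficients real, and adding twice the indicator of 1 lifts them to `2 + 2 Re (w ^ k) ≥ 0`. -/
theorem sum_range_coeff {q : ℕ} {z w : ℂ} (hz : z ^ q = 1) (hw : w ^ q = 1) (hw1 : ‖w‖ = 1) :
    ∑ k ∈ Finset.range q, ((2 + 2 * (w ^ k).re : ℝ) : ℂ) * z ^ k =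
      q * ((if z = w then 1 else 0) + (if z⁻¹ = w then 1 else 0) +
        2 * (if z = 1 then 1 else 0)) := by
  have hw0 : w ≠ 0 := fun h => by simp [h] at hw1
  have hterm : ∀ k, ((2 + 2 * (w ^ k).re : ℝ) : ℂ) * z ^ k =
      (z * w⁻¹) ^ k + (z * w) ^ k + 2 * z ^ k := fun k => by
    have := add_inv_of_norm_eq_one (z := w ^ k) (by rw [norm_pow, hw1, one_pow])
    rw [Complex.ofReal_add, ← this, mul_pow, mul_pow, inv_pow]
    push_cast
    ring
  simp_rw [hterm, Finset.sum_add_distrib, ← Finset.mul_sum]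
  rw [geom_sum_of_pow_eq_one hz, geom_sum_of_pow_eq_one (z := z * w⁻¹),
    geom_sum_of_pow_eq_one (z := z * w)]
  · have h1 : z * w⁻¹ = 1 ↔ z = w := mul_inv_eq_one₀ hw0
    have h2 : z * w = 1 ↔ z⁻¹ = w := by
      rw [inv_eq_iff_eq_inv]
      exact ⟨fun h => eq_inv_of_mul_eq_one_left h, fun h => by rw [h, inv_mul_cancel₀ hw0]⟩
    simp only [h1, h2]
    split_ifs <;> ring
  · rw [mul_pow, hz, hw, one_mul]
  · rw [mul_pow, hz, inv_pow, hw, inv_one, one_mul]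

/-- The residual weight has nonnegative Fourier coefficients. -/
theorem residualWeight_eq_sum {q : ℕ} (hq : q ≠ 0) (β : ℝ) {z : ℂ} (hz : z ^ q = 1) :
    (residualWeight q β z : ℂ) = ∑ j ∈ Finset.Ico 1 q, ∑ k ∈ Finset.range q,
      ((Real.exp (-β * (1 - (root q ^ j).re)) / (2 * q) * (2 + 2 * ((root q ^ j) ^ k).re) : ℝ) : ℂ)
        * z ^ k := by
  have hroot := isPrimitiveRoot_root hq
  have hn : ‖z‖ = 1 := Complex.norm_eq_one_of_pow_eq_one hz hq
  have hq' : (q : ℂ) ≠ 0 := Nat.cast_ne_zero.2 hq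
  have hinv : z⁻¹ ^ q = 1 := by rw [inv_pow, hz, inv_one]
  have hin : ∀ j, ∑ k ∈ Finset.range q,
      ((Real.exp (-β * (1 - (root q ^ j).re)) / (2 * q) * (2 + 2 * ((root q ^ j) ^ k).re) : ℝ) : ℂ)
        * z ^ k =
      ((Real.exp (-β * (1 - (root q ^ j).re)) * (if z = root q ^ j then 1 else 0) / 2 +
        Real.exp (-β * (1 - (root q ^ j).re)) * (if z⁻¹ = root q ^ j then 1 else 0) / 2 +
        Real.exp (-β * (1 - (root q ^ j).re)) * (if z = 1 then 1 else 0) : ℝ) : ℂ) := fun j => by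
    have hwq : (root q ^ j) ^ q = 1 := by
      rw [← pow_mul, mul_comm, pow_mul, hroot.pow_eq_one, one_pow]
    have h := sum_range_coeff hz hwq (norm_root_pow q j)
    calc _ = ((Real.exp (-β * (1 - (root q ^ j).re)) : ℝ) : ℂ) / (2 * q) *
          ∑ k ∈ Finset.range q, ((2 + 2 * ((root q ^ j) ^ k).re : ℝ) : ℂ) * z ^ k := by
          rw [Finset.mul_sum]
          refine Finset.sum_congr rfl fun k _ => ?_
          push_cast
          ring
      _ = _ := by
          rw [h]
          split_ifs <;> push_cast <;> field_simp
  simp_rw [hin]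
  rw [← Complex.ofReal_sum]
  congr 1
  rw [Finset.sum_add_distrib, Finset.sum_add_distrib, ← Finset.sum_div, ← Finset.sum_div,
    ← Finset.sum_mul, sum_ite_root_pow hq hz fun z => Real.exp (-β * (1 - z.re)),
    sum_ite_root_pow hq hinv fun z => Real.exp (-β * (1 - z.re)), inv_re_of_norm_eq_one hn]
  simp only [inv_eq_one]
  unfold residualWeight
  change _ = _ + disagreementWeight q β * _
  split_ifs with h
  · simp [h]
  · ring

/-! ### Functions of positive type -/

/-- The phase of the spin at `v` relative to the boundary spin `b`. -/
def phase {d q : ℕ} (Λ : Finset (Site d)) (b : Spin q) (v : Site d) : (Λ → Spin q) → ℂ :=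
  fun ζ => root q ^ (glue Λ (fun _ => b) ζ v : ℕ) * (root q ^ (b : ℕ))⁻¹

theorem phase_pow {d q : ℕ} (Λ : Finset (Site d)) (b : Spin q) (v : Site d) (ζ : Λ → Spin q) :
    phase Λ b v ζ ^ q = 1 := by
  have hroot := isPrimitiveRoot_root (q := q) (by have := b.2; omega)
  rw [phase, mul_pow, inv_pow, ← pow_mul, ← pow_mul, mul_comm, mul_comm _ q, mul_comm _ q,
    pow_mul, pow_mul, hroot.pow_eq_one]
  simp

/-- The combinations with nonnegative coefficients of products of phases. -/
def phaseCone {d q : ℕ} (Λ : Finset (Site d)) (b : Spin q) : Subsemiring ((Λ → Spin q) → ℂ) :=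
  Subsemiring.closure (Set.range (phase Λ b) ∪ {F | ∃ c : ℝ, 0 ≤ c ∧ F = fun _ => (c : ℂ)})

theorem phase_mem_phaseCone {d q : ℕ} (Λ : Finset (Site d)) (b : Spin q) (v : Site d) :
    phase Λ b v ∈ phaseCone Λ b :=
  Subsemiring.subset_closure (Or.inl ⟨v, rfl⟩)

theorem const_mem_phaseCone {d q : ℕ} (Λ : Finset (Site d)) (b : Spin q) {c : ℝ} (hc : 0 ≤ c) :
    (fun _ => (c : ℂ)) ∈ phaseCone Λ b :=
  Subsemiring.subset_closure (Or.inr ⟨c, hc, rfl⟩)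

/-- Phases at sites off `Λ` are identically 1, since phases are measured relative to `b`; only
monomials in the free spins remain. -/
theorem exists_monomial_of_mem_closure {d q : ℕ} (Λ : Finset (Site d)) (b : Spin q)
    {F : (Λ → Spin q) → ℂ} (hF : F ∈ Submonoid.closure
      (Set.range (phase Λ b) ∪ {F | ∃ c : ℝ, 0 ≤ c ∧ F = fun _ => (c : ℂ)})) :
    ∃ (c : ℝ) (m : Λ → ℕ), 0 ≤ c ∧ ∀ ζ, F ζ =
      c * ∏ v, (root q ^ (ζ v : ℕ) * (root q ^ (b : ℕ))⁻¹) ^ m v := by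
  classical
  induction hF using Submonoid.closure_induction with
  | mem F hF =>
    rcases hF with ⟨v, rfl⟩ | ⟨c, hc, rfl⟩
    · by_cases hv : v ∈ Λ
      · refine ⟨1, Pi.single ⟨v, hv⟩ 1, zero_le_one, fun ζ => ?_⟩
        rw [Finset.prod_eq_single_of_mem (⟨v, hv⟩ : Λ) (Finset.mem_univ _)]
        · simp [phase, glue, hv]
        · intro w _ hw
          simp [hw]
      · refine ⟨1, 0, zero_le_one, fun ζ => ?_⟩
        simp [phase, glue, hv, root_ne_zero]
    · exact ⟨c, 0, hc, fun ζ => by simp⟩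
  | one => exact ⟨1, 0, zero_le_one, fun ζ => by simp⟩
  | mul F G _ _ ihF ihG =>
    obtain ⟨c, m, hc, hF⟩ := ihF
    obtain ⟨c', m', hc', hG⟩ := ihG
    refine ⟨c * c', m + m', mul_nonneg hc hc', fun ζ => ?_⟩
    rw [Pi.mul_apply, hF, hG]
    simp only [Pi.add_apply, pow_add, Finset.prod_mul_distrib]
    push_cast
    ring

theorem sum_relative_phase_pow {q : ℕ} (b : Spin q) (m : ℕ) :
    ∃ s : ℝ, 0 ≤ s ∧ ∑ a : Spin q, (root q ^ (a : ℕ) * (root q ^ (b : ℕ))⁻¹) ^ m = s := by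
  have hq : q ≠ 0 := by have := b.2; omega
  have hroot := isPrimitiveRoot_root hq
  have hsum : ∑ a : Spin q, (root q ^ (a : ℕ) * (root q ^ (b : ℕ))⁻¹) ^ m =
      (((root q ^ m) ^ (b : ℕ)))⁻¹ * ∑ k ∈ Finset.range q, (root q ^ m) ^ k := by
    rw [Fin.sum_univ_eq_sum_range
      (fun k => (root q ^ k * (root q ^ (b : ℕ))⁻¹) ^ m) q, Finset.mul_sum]
    refine Finset.sum_congr rfl fun k _ => ?_
    rw [mul_pow, inv_pow, ← pow_mul, ← pow_mul, ← pow_mul, ← pow_mul, mul_comm m, mul_comm m,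
      mul_comm]
  rw [hsum, geom_sum_of_pow_eq_one
    (by rw [← pow_mul, mul_comm, pow_mul, hroot.pow_eq_one, one_pow])]
  split_ifs with h
  · exact ⟨q, Nat.cast_nonneg q, by simp [h]⟩
  · exact ⟨0, le_rfl, by simp⟩

/-- A form of Griffiths' first inequality: the sum of a monomial factors over sites into character
sums, each equal to `q` or 0. -/
theorem sum_nonneg_of_mem_phaseCone {d q : ℕ} {Λ : Finset (Site d)} {b : Spin q}
    {F : (Λ → Spin q) → ℂ} (hF : F ∈ phaseCone Λ b) :
    ∃ s : ℝ, 0 ≤ s ∧ ∑ ζ, F ζ = s := by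
  classical
  rw [phaseCone, Subsemiring.mem_closure_iff] at hF
  induction hF using AddSubmonoid.closure_induction with
  | mem F hF =>
    obtain ⟨c, m, hc, hF⟩ := exists_monomial_of_mem_closure Λ b hF
    choose s hs hsum using sum_relative_phase_pow b
    refine ⟨c * ∏ v, s (m v), mul_nonneg hc (Finset.prod_nonneg fun v _ => hs _), ?_⟩
    simp_rw [hF]
    rw [← Finset.mul_sum, ← Fintype.prod_sum
      fun (v : Λ) (a : Spin q) => (root q ^ (a : ℕ) * (root q ^ (b : ℕ))⁻¹) ^ m v]
    simp_rw [hsum]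
    push_cast
    rfl
  | zero => exact ⟨0, le_rfl, by simp⟩
  | add F G _ _ ihF ihG =>
    obtain ⟨s, hs, hF⟩ := ihF
    obtain ⟨s', hs', hG⟩ := ihG
    exact ⟨s + s', add_nonneg hs hs', by simp [Finset.sum_add_distrib, hF, hG]⟩

/-- The real functions of positive type. -/
def positiveType {d q : ℕ} (Λ : Finset (Site d)) (b : Spin q) :
    Subsemiring ((Λ → Spin q) → ℝ) :=
  (phaseCone Λ b).comap (RingHom.compLeft Complex.ofRealHom (Λ → Spin q))

theorem mem_positiveType {d q : ℕ} {Λ : Finset (Site d)} {b : Spin q}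
    {F : (Λ → Spin q) → ℝ} :
    F ∈ positiveType Λ b ↔ (fun ζ => (F ζ : ℂ)) ∈ phaseCone Λ b := Iff.rfl

theorem exists_sum_mul_pow {d q : ℕ} {Λ : Finset (Site d)} {b : Spin q}
    {F : (Λ → Spin q) → ℝ} (hF : F ∈ positiveType Λ b) {z : (Λ → Spin q) → ℂ}
    (hz : z ∈ phaseCone Λ b) (k : ℕ) : ∃ s : ℝ, 0 ≤ s ∧ ∑ ζ, (F ζ : ℂ) * z ζ ^ k = s :=
  sum_nonneg_of_mem_phaseCone (mul_mem (mem_positiveType.1 hF) (pow_mem hz k))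

/-- Expanding `q 1[z = 1]` as the sum of `z ^ k` over `k < q` turns the right side into a sum of
nonnegative terms, of which `k = 0` is the left side. -/
theorem sum_le_mul_sum_indicator {d q : ℕ} {Λ : Finset (Site d)} {b : Spin q}
    {F : (Λ → Spin q) → ℝ} (hF : F ∈ positiveType Λ b) {z : (Λ → Spin q) → ℂ}
    (hz : z ∈ phaseCone Λ b) (hzq : ∀ ζ, z ζ ^ q = 1) :
    ∑ ζ, F ζ ≤ q * ∑ ζ, F ζ * (if z ζ = 1 then 1 else 0) := by
  choose s hs hsum using exists_sum_mul_pow hF hz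
  have h0 : s 0 = ∑ ζ, F ζ := by
    have := hsum 0
    simp only [pow_zero, mul_one] at this
    exact_mod_cast this.symm
  have htot : ∑ k ∈ Finset.range q, s k = q * ∑ ζ, F ζ * (if z ζ = 1 then 1 else 0) := by
    have : (∑ k ∈ Finset.range q, (s k : ℂ)) =
        q * ∑ ζ, (F ζ : ℂ) * (if z ζ = 1 then 1 else 0) := by
      simp_rw [← hsum]
      rw [Finset.sum_comm, Finset.mul_sum]
      refine Finset.sum_congr rfl fun ζ _ => ?_
      rw [← Finset.mul_sum, geom_sum_of_pow_eq_one (hzq ζ)]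
      split_ifs <;> ring
    apply Complex.ofReal_injective
    push_cast [apply_ite Complex.ofReal]
    exact this
  rw [← htot, ← h0]
  exact Finset.single_le_sum (fun k _ => hs k)
    (Finset.mem_range.2 (by have := b.2; omega))

/-- With `s k` the sum of `F` times the `k`-th power of the phase at `x`, Fourier expansion of both
indicators gives `∑ s k (1 - κ ^ k) / q`. Here `s k ≥ 0` and `κ` has modulus one, so the real part
is nonnegative. -/
theorem sum_mul_boundary_sub_nonneg {d q : ℕ} {Λ : Finset (Site d)} {b : Spin q} (a : Spin q)
    {F : (Λ → Spin q) → ℝ} (hF : F ∈ positiveType Λ b) (x : Site d) :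
    0 ≤ ∑ ζ, ((if glue Λ (fun _ => b) ζ x = b then 1 else 0) -
      (if glue Λ (fun _ => b) ζ x = a then 1 else 0)) * F ζ := by
  have hq : q ≠ 0 := by have := b.2; omega
  have hroot := isPrimitiveRoot_root hq
  have hpow : ∀ i : ℕ, (root q ^ i) ^ q = 1 := fun i => by
    rw [← pow_mul, mul_comm, pow_mul, hroot.pow_eq_one, one_pow]
  have hne : ∀ i : ℕ, root q ^ i ≠ 0 := fun i => pow_ne_zero i (root_ne_zero q)
  choose s hs hsum using exists_sum_mul_pow hF (phase_mem_phaseCone Λ b x)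
  set κ : ℂ := root q ^ (b : ℕ) * (root q ^ (a : ℕ))⁻¹ with hκ
  have hκn : ∀ k, ‖κ ^ k‖ = 1 := fun k => by
    rw [norm_pow, hκ, norm_mul, norm_inv, norm_root_pow, norm_root_pow]; simp
  have hκq : κ ^ q = 1 := by rw [hκ, mul_pow, inv_pow, hpow, hpow]; simp
  have hinj : ∀ c e : Spin q, root q ^ (c : ℕ) = root q ^ (e : ℕ) ↔ c = e := fun c e =>
    ⟨fun h => Fin.ext (hroot.pow_inj c.2 e.2 h), fun h => by rw [h]⟩
  have hb : ∀ ζ, phase Λ b x ζ = 1 ↔ glue Λ (fun _ => b) ζ x = b := fun ζ => by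
    rw [phase, mul_inv_eq_one₀ (hne _), hinj]
  have ha : ∀ ζ, phase Λ b x ζ * κ = 1 ↔ glue Λ (fun _ => b) ζ x = a := fun ζ => by
    rw [phase, hκ, mul_assoc, inv_mul_cancel_left₀ (hne _), mul_inv_eq_one₀ (hne _), hinj]
  have key : (q : ℂ) * ((∑ ζ, ((if glue Λ (fun _ => b) ζ x = b then 1 else 0) -
      (if glue Λ (fun _ => b) ζ x = a then 1 else 0)) * F ζ : ℝ) : ℂ) =
      ∑ k ∈ Finset.range q, (s k : ℂ) * (1 - κ ^ k) := by
    simp_rw [← hsum, Finset.sum_mul]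
    rw [Finset.sum_comm, Complex.ofReal_sum, Finset.mul_sum]
    refine Finset.sum_congr rfl fun ζ _ => ?_
    have h1 := geom_sum_of_pow_eq_one (phase_pow Λ b x ζ)
    have h2 := geom_sum_of_pow_eq_one (z := phase Λ b x ζ * κ)
      (by rw [mul_pow, phase_pow, hκq, one_mul])
    have h3 : ∑ k ∈ Finset.range q, (F ζ : ℂ) * phase Λ b x ζ ^ k * (1 - κ ^ k) =
        F ζ * (∑ k ∈ Finset.range q, phase Λ b x ζ ^ k -
          ∑ k ∈ Finset.range q, (phase Λ b x ζ * κ) ^ k) := by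
      rw [← Finset.sum_sub_distrib, Finset.mul_sum]
      refine Finset.sum_congr rfl fun k _ => ?_
      rw [mul_pow]; ring
    rw [h3, h1, h2]
    simp only [hb, ha]
    split_ifs <;> push_cast <;> ring
  have hre := congrArg Complex.re key
  rw [← Complex.ofReal_natCast, ← Complex.ofReal_mul, Complex.ofReal_re, Complex.re_sum] at hre
  have hpos : 0 ≤ ∑ k ∈ Finset.range q, ((s k : ℂ) * (1 - κ ^ k)).re :=
    Finset.sum_nonneg fun k _ => by
      rw [Complex.re_ofReal_mul, Complex.sub_re, Complex.one_re]
      exact mul_nonneg (hs k)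
        (sub_nonneg.2 (abs_le.1 (re_le_one_of_norm_eq_one (hκn k))).2)
  rw [← hre] at hpos
  exact nonneg_of_mul_nonneg_right hpos (Nat.cast_pos.2 (Nat.pos_of_ne_zero hq))

theorem indicator_mem_positiveType {d q : ℕ} {Λ : Finset (Site d)} {b : Spin q}
    {z : (Λ → Spin q) → ℂ} (hz : z ∈ phaseCone Λ b) (hzq : ∀ ζ, z ζ ^ q = 1) :
    (fun ζ => if z ζ = 1 then (1 : ℝ) else 0) ∈ positiveType Λ b := by
  have hq : (q : ℂ) ≠ 0 := Nat.cast_ne_zero.2 (by have := b.2; omega)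
  rw [mem_positiveType]
  have : (fun ζ => ((if z ζ = 1 then (1 : ℝ) else 0 : ℝ) : ℂ)) =
      ∑ k ∈ Finset.range q, (fun _ => (((q : ℝ)⁻¹ : ℝ) : ℂ)) * z ^ k := by
    funext ζ
    simp only [Finset.sum_apply, Pi.mul_apply, Pi.pow_apply]
    rw [← Finset.mul_sum, geom_sum_of_pow_eq_one (hzq ζ)]
    split_ifs <;> simp [hq]
  rw [this]
  exact sum_mem fun k _ => mul_mem (const_mem_phaseCone Λ b (by positivity)) (pow_mem hz k)

theorem residualWeight_mem_positiveType {d q : ℕ} {Λ : Finset (Site d)} {b : Spin q} (β : ℝ)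
    {z : (Λ → Spin q) → ℂ} (hz : z ∈ phaseCone Λ b) (hzq : ∀ ζ, z ζ ^ q = 1) :
    (fun ζ => residualWeight q β (z ζ)) ∈ positiveType Λ b := by
  have hq : q ≠ 0 := by have := b.2; omega
  rw [mem_positiveType]
  have : (fun ζ => (residualWeight q β (z ζ) : ℂ)) =
      ∑ j ∈ Finset.Ico 1 q, ∑ k ∈ Finset.range q,
        (fun _ => ((Real.exp (-β * (1 - (root q ^ j).re)) / (2 * q) *
          (2 + 2 * ((root q ^ j) ^ k).re) : ℝ) : ℂ)) * z ^ k := by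
    funext ζ
    simp only [Finset.sum_apply, Pi.mul_apply, Pi.pow_apply]
    exact residualWeight_eq_sum hq β (hzq ζ)
  rw [this]
  refine sum_mem fun j _ => sum_mem fun k _ =>
    mul_mem (const_mem_phaseCone Λ b ?_) (pow_mem hz k)
  have : |((root q ^ j) ^ k).re| ≤ 1 :=
    re_le_one_of_norm_eq_one (by rw [norm_pow, norm_root_pow, one_pow])
  have := (abs_le.1 this).1
  exact mul_nonneg (by positivity) (by linarith)

/-- The phase difference across an edge involves an inverse, which is not a generator of the cone.
For `q`-th roots of unity it is the power `q - 1`, so the difference still lies in the cone. -/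
theorem exists_phase_edge {d q : ℕ} (Λ : Finset (Site d)) (b : Spin q) (e : Sym2 (Site d)) :
    ∃ z ∈ phaseCone Λ b, (∀ ζ, z ζ ^ q = 1) ∧
      (∀ ζ, edgeEnergy (glue Λ (fun _ => b) ζ) e = 1 - (z ζ).re) ∧
      ∀ ζ, z ζ = 1 → ∀ x ∈ e, ∀ y ∈ e, glue Λ (fun _ => b) ζ x = glue Λ (fun _ => b) ζ y := by
  have hq : q ≠ 0 := by have := b.2; omega
  have hroot := isPrimitiveRoot_root hq
  induction e using Sym2.ind with
  | _ x y =>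
    have hval : ∀ ζ, phase Λ b x ζ * phase Λ b y ζ ^ (q - 1) =
        root q ^ (glue Λ (fun _ => b) ζ x : ℕ) * (root q ^ (glue Λ (fun _ => b) ζ y : ℕ))⁻¹ :=
      fun ζ => by
        have h : phase Λ b y ζ ^ (q - 1) = (phase Λ b y ζ)⁻¹ := by
          refine eq_inv_of_mul_eq_one_left ?_
          rw [← pow_succ, Nat.sub_add_cancel (by omega), phase_pow]
        have hb : root q ^ (b : ℕ) ≠ 0 := pow_ne_zero _ (root_ne_zero q)
        rw [h, phase, phase, mul_inv, inv_inv]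
        field_simp
    refine ⟨phase Λ b x * phase Λ b y ^ (q - 1), mul_mem (phase_mem_phaseCone Λ b x)
      (pow_mem (phase_mem_phaseCone Λ b y) _), fun ζ => ?_, fun ζ => ?_, fun ζ hζ => ?_⟩
    · rw [Pi.mul_apply, Pi.pow_apply, mul_pow, ← pow_mul, mul_comm (q - 1), pow_mul, phase_pow,
        phase_pow, one_pow, one_mul]
    · rw [Pi.mul_apply, Pi.pow_apply, hval, root_pow_eq_exp, root_pow_eq_exp, ← Complex.exp_neg,
        ← Complex.exp_add, ← neg_mul, ← add_mul, ← Complex.ofReal_neg, ← Complex.ofReal_add,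
        Complex.exp_ofReal_mul_I_re]
      rfl
    · rw [Pi.mul_apply, Pi.pow_apply, hval,
        mul_inv_eq_one₀ (pow_ne_zero _ (root_ne_zero q))] at hζ
      have hxy : glue Λ (fun _ => b) ζ x = glue Λ (fun _ => b) ζ y :=
        Fin.ext (hroot.pow_inj (Fin.is_lt _) (Fin.is_lt _) hζ)
      intro u hu v hv
      rcases Sym2.mem_iff.1 hu with rfl | rfl <;> rcases Sym2.mem_iff.1 hv with rfl | rfl <;>
        simp [hxy]

/-! ### Comparison with Bernoulli percolation -/

/-- The expectation of `h` evaluated at a random subset of `U` that contains each element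
independently with probability `r`. -/
def subsetExpectation {E : Type*} (r : ℝ) (U : Finset E) (h : Finset E → ℝ) : ℝ :=
  ∑ S ∈ U.powerset, r ^ S.card * (1 - r) ^ (U.card - S.card) * h S

theorem subsetExpectation_insert {E : Type*} [DecidableEq E] (r : ℝ) {U : Finset E} {e : E}
    (he : e ∉ U) (h : Finset E → ℝ) :
    subsetExpectation r (insert e U) h =
      r * subsetExpectation r U (fun S => h (insert e S)) +
        (1 - r) * subsetExpectation r U h := by
  unfold subsetExpectation
  rw [Finset.sum_powerset_insert he, Finset.mul_sum, Finset.mul_sum, add_comm]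
  congr 1 <;> refine Finset.sum_congr rfl fun S hS => ?_
  · rw [Finset.card_insert_of_notMem he,
      Finset.card_insert_of_notMem fun h => he (Finset.mem_powerset.1 hS h),
      Nat.add_sub_add_right, pow_succ]
    ring
  · rw [Finset.card_insert_of_notMem he,
      Nat.succ_sub (Finset.card_le_card (Finset.mem_powerset.1 hS)), pow_succ]
    ring

theorem subsetExpectation_mono {E : Type*} {r : ℝ} (hr0 : 0 ≤ r) (hr1 : r ≤ 1) (U : Finset E)
    {h h' : Finset E → ℝ} (hh : ∀ S, h S ≤ h' S) :
    subsetExpectation r U h ≤ subsetExpectation r U h' :=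
  Finset.sum_le_sum fun S _ => mul_le_mul_of_nonneg_left (hh S)
    (mul_nonneg (pow_nonneg hr0 _) (pow_nonneg (sub_nonneg.2 hr1) _))

/-- Edges with weight `t * I e + C e`, where `I e` is the weight of an open and `C e` that of a
closed edge, dominate independent edges open with probability `r`, provided that each edge is,
conditionally on the others, open with probability at least `r`. -/
theorem subsetExpectation_mul_sum_le {X E : Type*} [Fintype X] [DecidableEq E]
    (K : Subsemiring (X → ℝ)) {r t : ℝ} (hr0 : 0 ≤ r) (hr1 : r ≤ 1) (I C : E → X → ℝ)
    (ht : (fun _ => t) ∈ K) (ht0 : 0 ≤ t)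
    (hI : ∀ e, I e ∈ K) (hC : ∀ e, C e ∈ K) (hI0 : ∀ e x, 0 ≤ I e x) (hC0 : ∀ e x, 0 ≤ C e x)
    (φ : X → ℝ)
    (hopen : ∀ e, ∀ F ∈ K, (∀ x, 0 ≤ F x) →
      r * ∑ x, F x * C e x ≤ (1 - r) * (t * ∑ x, F x * I e x))
    (U : Finset E) : ∀ (B : X → ℝ) (_ : B ∈ K) (_ : ∀ x, 0 ≤ B x) (h : Finset E → ℝ)
      (_ : ∀ e S, h S ≤ h (insert e S))
      (_ : ∀ S ⊆ U, h S * ∑ x, B x * ((∏ e ∈ S, I e x) * ∏ e ∈ U \ S, C e x) ≤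
        ∑ x, φ x * (B x * ((∏ e ∈ S, I e x) * ∏ e ∈ U \ S, C e x))),
      subsetExpectation r U h * ∑ x, B x * ∏ e ∈ U, (t * I e x + C e x) ≤
        ∑ x, φ x * (B x * ∏ e ∈ U, (t * I e x + C e x)) := by
  induction U using Finset.induction_on with
  | empty =>
    intro B _ _ h _ hbase
    simpa [subsetExpectation] using hbase ∅ (Finset.Subset.refl _)
  | insert e U he ih =>
    intro B hB hB0 h hmono hbase
    -- Fix the label of `e` and absorb its factor into the background: first open, then closed.
    have h1 := ih (B * I e) (mul_mem hB (hI e)) (fun x => mul_nonneg (hB0 x) (hI0 e x))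
      (fun S => h (insert e S)) (fun e' S => by
        rw [Finset.insert_comm]; exact hmono _ _) (fun S hS => by
        have heS : e ∉ S := fun h => he (hS h)
        have := hbase (insert e S) (Finset.insert_subset_insert e hS)
        rw [Finset.insert_sdiff_insert, Finset.sdiff_insert_of_notMem he] at this
        simpa only [Finset.prod_insert heS, Pi.mul_apply, mul_assoc] using this)
    have h0 := ih (B * C e) (mul_mem hB (hC e)) (fun x => mul_nonneg (hB0 x) (hC0 e x))
      h hmono (fun S hS => by
        have heS : e ∉ S := fun h => he (hS h)
        have := hbase S (hS.trans (Finset.subset_insert e U))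
        rw [Finset.insert_sdiff_of_notMem _ heS] at this
        have heUS : e ∉ U \ S := fun h => he (Finset.mem_sdiff.1 h).1
        simp only [Finset.prod_insert heUS] at this
        convert this using 2
        · refine Finset.sum_congr rfl fun x _ => ?_
          rw [Pi.mul_apply]; ring
        · rw [Pi.mul_apply]; ring)
    set W : X → ℝ := fun x => ∏ e ∈ U, (t * I e x + C e x) with hW
    have hWK : W ∈ K := by
      have : W = ∏ e ∈ U, ((fun _ => t) * I e + C e) := by
        funext x; simp [hW, Finset.prod_apply]
      rw [this]
      exact prod_mem fun e _ => add_mem (mul_mem ht (hI e)) (hC e)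
    have hW0 : ∀ x, 0 ≤ W x := fun x =>
      Finset.prod_nonneg fun e _ => add_nonneg (mul_nonneg ht0 (hI0 e x)) (hC0 e x)
    -- Apply the conditional bound for `e` with the labels of all edges in `U` summed out.
    have hBW := hopen e (B * W) (mul_mem hB hWK) fun x => mul_nonneg (hB0 x) (hW0 x)
    have hge := subsetExpectation_mono hr0 hr1 U fun S => hmono e S
    rw [subsetExpectation_insert r he]
    set a := subsetExpectation r U fun S => h (insert e S)
    set c := subsetExpectation r U h
    simp only [Finset.prod_insert he]
    simp only [Pi.mul_apply] at h1 h0 hBW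
    have e1 : ∑ x, B x * I e x * W x = ∑ x, B x * W x * I e x :=
      Finset.sum_congr rfl fun x _ => by ring
    have e0 : ∑ x, B x * C e x * W x = ∑ x, B x * W x * C e x :=
      Finset.sum_congr rfl fun x _ => by ring
    change a * ∑ x, B x * I e x * W x ≤ ∑ x, φ x * (B x * I e x * W x) at h1
    change c * ∑ x, B x * C e x * W x ≤ ∑ x, φ x * (B x * C e x * W x) at h0
    rw [e1] at h1
    rw [e0] at h0
    have e2 : ∑ x, B x * ((t * I e x + C e x) * W x) =
        t * ∑ x, B x * W x * I e x + ∑ x, B x * W x * C e x := by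
      rw [Finset.mul_sum, ← Finset.sum_add_distrib]
      exact Finset.sum_congr rfl fun x _ => by ring
    have e3 : ∑ x, φ x * (B x * ((t * I e x + C e x) * W x)) =
        t * ∑ x, φ x * (B x * I e x * W x) + ∑ x, φ x * (B x * C e x * W x) := by
      rw [Finset.mul_sum, ← Finset.sum_add_distrib]
      exact Finset.sum_congr rfl fun x _ => by ring
    change (r * a + (1 - r) * c) * ∑ x, B x * ((t * I e x + C e x) * W x) ≤
      ∑ x, φ x * (B x * ((t * I e x + C e x) * W x))
    rw [e2, e3]
    -- With `O` and `D` the total weights with `e` open and closed, `a O + c D - (r a + (1 - r) c)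
    -- (O + D) = (a - c) ((1 - r) O - r D)`, and both factors are nonnegative.
    have h1' := mul_le_mul_of_nonneg_left h1 ht0
    have h2 := mul_le_mul_of_nonneg_left hBW (sub_nonneg.2 hge)
    linarith

theorem disorderLaw_real_filter {d : ℕ} (r : unitInterval) (U : Finset (Edge d))
    (P : Finset (Edge d) → Prop) [DecidablePred P] :
    (disorderLaw d r).real {ω | P (U.filter fun e => ω e = true)} =
      subsetExpectation r U fun S => if P S then 1 else 0 := by
  classical
  have hpt : ∀ S ∈ U.powerset, (disorderLaw d r).real {ω | U.filter (fun e => ω e = true) = S} =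
      (r : ℝ) ^ S.card * (1 - (r : ℝ)) ^ (U.card - S.card) := fun S hS => by
    rw [Finset.mem_powerset] at hS
    have hset : {ω : Disorder d | U.filter (fun e => ω e = true) = S} =
        Set.pi U fun e => {decide (e ∈ S)} := by
      ext ω
      simp only [Finset.ext_iff, Finset.mem_filter, Set.mem_pi, Set.mem_ofPred_eq,
        Set.mem_singleton_iff, Finset.mem_coe]
      refine ⟨fun h e he => ?_, fun h e => ⟨fun ⟨he, hω⟩ => ?_, fun heS => ⟨hS heS, ?_⟩⟩⟩
      · rw [Bool.eq_iff_iff, decide_eq_true_iff, ← h e]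
        exact ⟨fun hω => ⟨he, hω⟩, fun hω => hω.2⟩
      · simpa [hω] using h e he
      · simpa [heS] using h e (hS heS)
    rw [hset, measureReal_def, disorderLaw,
      Measure.infinitePi_pi (μ := fun _ : Edge d => bernoulliMeasure true false r)
        (t := fun e => {decide (e ∈ S)}) fun e _ => measurableSet_singleton _,
      ENNReal.toReal_prod, ← Finset.prod_sdiff hS,
      Finset.prod_eq_pow_card (b := 1 - (r : ℝ)) (s := U \ S),
      Finset.prod_eq_pow_card (b := (r : ℝ)) (s := S),
      Finset.card_sdiff_of_subset hS, mul_comm]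
    · intro e he
      simp [he]
    · intro e he
      simp [(Finset.mem_sdiff.1 he).2]
  have hmeas : ∀ S, MeasurableSet {ω : Disorder d | U.filter (fun e => ω e = true) = S} :=
    fun S => by
      have : {ω : Disorder d | U.filter (fun e => ω e = true) = S} =
          ⋂ e : Edge d, {ω | (e ∈ U ∧ ω e = true) ↔ e ∈ S} := by
        ext ω
        simp [Finset.ext_iff]
      rw [this]
      exact MeasurableSet.iInter fun e => (measurable_pi_apply (X := fun _ : Edge d => Bool) e)
        (Set.toFinite {w : Bool | (e ∈ U ∧ w = true) ↔ e ∈ S}).measurableSet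
  have hunion : {ω : Disorder d | P (U.filter fun e => ω e = true)} =
      ⋃ S ∈ U.powerset.filter P, {ω | U.filter (fun e => ω e = true) = S} := by
    ext ω
    simp only [Set.mem_ofPred_eq, Set.mem_iUnion, Finset.mem_filter, Finset.mem_powerset]
    exact ⟨fun h => ⟨_, ⟨Finset.filter_subset _ _, h⟩, rfl⟩, fun ⟨S, ⟨_, h⟩, hS⟩ => hS ▸ h⟩
  rw [hunion, measureReal_biUnion_finset
    (fun S _ S' _ hSS' => Set.disjoint_left.2 fun ω hS hS' => hSS' (hS.symm.trans hS'))
    fun S _ => hmeas S, Finset.sum_filter]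
  refine Finset.sum_congr rfl fun S hS => ?_
  by_cases hP : P S
  · simp [hP, hpt S hS]
  · simp [hP]

/-- The disorder whose open edges are those of `S`. -/
def openOn {d : ℕ} (S : Finset (Edge d)) : Disorder d := open Classical in fun e => decide (e ∈ S)

/-- The sites of `S`-clusters that reach the complement of `Λ`. -/
def ConnectedToCompl {d : ℕ} (Λ : Finset (Site d)) (x : Site d) (S : Finset (Edge d)) : Prop :=
  ∃ y ∉ Λ, (openGraph (openOn S)).Reachable x y

theorem ConnectedToCompl.mono {d : ℕ} {Λ : Finset (Site d)} {x : Site d} {S T : Finset (Edge d)}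
    (hST : S ⊆ T) : ConnectedToCompl Λ x S → ConnectedToCompl Λ x T := by
  rintro ⟨y, hy, h⟩
  exact ⟨y, hy, reachable_mono (fun e he => by
    simp only [openOn, decide_eq_true_iff] at he ⊢
    exact hST he) h⟩

/-- An infinite cluster leaves `Λ`. If no site off `Λ` were reached through `S`, each step of a
`J`-open path from `x` would start in `Λ`, hence use an edge of `S`, and the path could never exit.
-/
theorem connectedToCompl_of_cluster_infinite {d : ℕ} {J : Disorder d} {Λ : Finset (Site d)}
    {x : Site d} {S : Finset (Edge d)} (hS : ∀ e ∈ touching Λ, J e = true → e ∈ S)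
    (hx : (cluster J x).Infinite) : ConnectedToCompl Λ x S := by
  obtain ⟨y, hy, hyΛ⟩ := hx.exists_notMem_finset Λ
  by_contra hcon
  have hstay : ∀ z, Relation.ReflTransGen (openGraph J).Adj x z →
      (openGraph (openOn S)).Reachable x z := by
    intro z hz
    induction hz with
    | refl => exact SimpleGraph.Reachable.refl x
    | @tail u v _ huv ih =>
      obtain ⟨hadj, hJ⟩ := huv
      have hu : u ∈ Λ := by
        by_contra hu
        exact hcon ⟨u, hu, ih⟩
      refine ih.trans (SimpleGraph.Adj.reachable ⟨hadj, ?_⟩)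
      simp only [openOn, decide_eq_true_iff]
      exact hS _ (mem_touching.2 ⟨u, hu, Sym2.mem_mk_left u v⟩) hJ
  exact hcon ⟨y, hyΛ, hstay y ((SimpleGraph.reachable_iff_reflTransGen x y).1 hy)⟩

/-- In finite volume, the boundary spin is favoured over any other spin by at least the
probability that the thinned cluster is infinite. -/
theorem cluster_infinite_le_integral_spec {d q : ℕ} {β : ℝ} {r : unitInterval}
    (hβ : (r : ℝ) * (q * disagreementWeight q β) ≤ (1 - r) * (1 - disagreementWeight q β))
    (hδ : disagreementWeight q β ≤ 1)
    (J : Disorder d) (Λ : Finset (Site d)) (x : Site d) {a b : Spin q} (hab : a ≠ b) :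
    (disorderLaw d r).real {ω | (cluster (thin J ω) x).Infinite} ≤
      ∫ σ, ((if σ x = b then 1 else 0) - (if σ x = a then 1 else 0))
        ∂(spec β J Λ (fun _ => b) : Measure (Config d q)) := by
  classical
  have hq : q ≠ 0 := by have := b.2; omega
  set δ := disagreementWeight q β with hδdef
  have hδ0 : 0 ≤ δ := disagreementWeight_nonneg q β
  choose z hz hzq hzE hzeq using fun e : Edge d => exists_phase_edge Λ b e.1
  set I : Edge d → (Λ → Spin q) → ℝ := fun e ζ => if z e ζ = 1 then 1 else 0 with hI
  set C : Edge d → (Λ → Spin q) → ℝ := fun e ζ => residualWeight q β (z e ζ) with hC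
  set φ : (Λ → Spin q) → ℝ := fun ζ => (if glue Λ (fun _ => b) ζ x = b then 1 else 0) -
    (if glue Λ (fun _ => b) ζ x = a then 1 else 0) with hφ
  set U : Finset (Edge d) := (touching Λ).filter fun e => J e = true with hU
  have hI0 : ∀ e ζ, 0 ≤ I e ζ := fun e ζ => by simp only [hI]; split_ifs <;> norm_num
  have hC0 : ∀ e ζ, 0 ≤ C e ζ := fun e ζ => residualWeight_nonneg β _
  have hIK : ∀ e, I e ∈ positiveType Λ b := fun e => indicator_mem_positiveType (hz e) (hzq e)
  have hCK : ∀ e, C e ∈ positiveType Λ b := fun e =>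
    residualWeight_mem_positiveType β (hz e) (hzq e)
  -- The closed factor is at most `δ`, while the open event carries at least a fraction `1/q` of the
  -- mass of `F`; `hβ` is exactly the inequality this requires.
  have hopen : ∀ e, ∀ F ∈ positiveType Λ b, (∀ ζ, 0 ≤ F ζ) →
      r * ∑ ζ, F ζ * C e ζ ≤ (1 - r) * ((1 - δ) * ∑ ζ, F ζ * I e ζ) := fun e F hF hF0 => by
    have h1 := sum_le_mul_sum_indicator hF (hz e) (hzq e)
    have h2 : ∑ ζ, F ζ * C e ζ ≤ δ * ∑ ζ, F ζ := by
      rw [Finset.mul_sum]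
      refine Finset.sum_le_sum fun ζ _ => ?_
      rw [mul_comm]
      exact mul_le_mul_of_nonneg_right (residualWeight_le hq β (hzq e ζ)) (hF0 ζ)
    have h3 : 0 ≤ ∑ ζ, F ζ * I e ζ :=
      Finset.sum_nonneg fun ζ _ => mul_nonneg (hF0 ζ) (hI0 e ζ)
    calc r * ∑ ζ, F ζ * C e ζ ≤ r * (δ * (q * ∑ ζ, F ζ * I e ζ)) :=
          mul_le_mul_of_nonneg_left (h2.trans (mul_le_mul_of_nonneg_left h1 hδ0)) r.2.1
      _ = r * (q * δ) * ∑ ζ, F ζ * I e ζ := by ring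
      _ ≤ (1 - r) * (1 - δ) * ∑ ζ, F ζ * I e ζ := mul_le_mul_of_nonneg_right hβ h3
      _ = _ := by ring
  have hbase : ∀ S ⊆ U, (if ConnectedToCompl Λ x S then (1 : ℝ) else 0) *
      ∑ ζ, (1 : (Λ → Spin q) → ℝ) ζ * ((∏ e ∈ S, I e ζ) * ∏ e ∈ U \ S, C e ζ) ≤
      ∑ ζ, φ ζ * ((1 : (Λ → Spin q) → ℝ) ζ * ((∏ e ∈ S, I e ζ) * ∏ e ∈ U \ S, C e ζ)) := by
    intro S _
    simp only [Pi.one_apply, one_mul]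
    split_ifs with hconn
    · rw [one_mul]
      refine le_of_eq (Finset.sum_congr rfl fun ζ _ => ?_)
      -- Either the spin is constant along `S`, so that `σ_x = b` and `φ = 1`, or some open factor
      -- vanishes.
      by_cases hall : ∀ e ∈ S, z e ζ = 1
      · obtain ⟨y, hy, hxy⟩ := hconn
        have hconst : ∀ v, Relation.ReflTransGen (openGraph (openOn S)).Adj x v →
            glue Λ (fun _ => b) ζ x = glue Λ (fun _ => b) ζ v := by
          intro v hv
          induction hv with
          | refl => rfl
          | @tail u w _ huw ih =>
            obtain ⟨hadj, hS⟩ := huw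
            simp only [openOn, decide_eq_true_iff] at hS
            exact ih.trans (hzeq _ ζ (hall _ hS) u (Sym2.mem_mk_left u w) w
              (Sym2.mem_mk_right u w))
        have hxb : glue Λ (fun _ => b) ζ x = b := by
          rw [hconst y ((SimpleGraph.reachable_iff_reflTransGen x y).1 hxy),
            glue_of_notMem _ _ hy]
        simp [hφ, hxb, hab.symm]
      · push Not at hall
        obtain ⟨e, heS, he⟩ := hall
        rw [Finset.prod_eq_zero heS (by simp [hI, he])]
        simp
    · rw [zero_mul]
      -- Without a connection to the boundary the label weight is still of positive type, which
      -- suffices for the lower bound 0.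
      refine sum_mul_boundary_sub_nonneg a ?_ x
      have : (fun ζ => (∏ e ∈ S, I e ζ) * ∏ e ∈ U \ S, C e ζ) =
          (∏ e ∈ S, I e) * ∏ e ∈ U \ S, C e := by
        funext ζ; simp [Finset.prod_apply]
      rw [this]
      exact mul_mem (prod_mem fun e _ => hIK e) (prod_mem fun e _ => hCK e)
  have hmono : ∀ e S, (if ConnectedToCompl Λ x S then (1 : ℝ) else 0) ≤
      if ConnectedToCompl Λ x (insert e S) then 1 else 0 := fun e S => by
    by_cases h : ConnectedToCompl Λ x S
    · rw [if_pos h, if_pos (h.mono (Finset.subset_insert e S))]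
    · rw [if_neg h]; split_ifs <;> norm_num
  have hmain := subsetExpectation_mul_sum_le (positiveType Λ b) r.2.1 r.2.2 I C
    (const_mem_phaseCone Λ b (sub_nonneg.2 hδ)) (sub_nonneg.2 hδ) hIK hCK hI0 hC0 φ hopen U 1
    (one_mem _) (fun _ => zero_le_one) (fun S => if ConnectedToCompl Λ x S then (1 : ℝ) else 0)
    hmono hbase
  rw [← disorderLaw_real_filter] at hmain
  -- Summing over labels restores the Boltzmann factor of each `J`-open edge; closed edges of `J`
  -- contribute 1.
  have hweight : ∀ ζ, ∏ e ∈ U, ((1 - δ) * I e ζ + C e ζ) =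
      Real.exp (-β * hamiltonian Λ J (glue Λ (fun _ => b) ζ)) := fun ζ => by
    rw [hamiltonian, Finset.mul_sum, Real.exp_sum, hU, Finset.prod_filter]
    refine Finset.prod_congr rfl fun e _ => ?_
    split_ifs with hJ
    · rw [one_mul, hzE]
      simp only [hI, hC, residualWeight]
      ring
    · simp
  simp only [hweight, Pi.one_apply, one_mul] at hmain
  have hZ := partitionFunction_pos β J Λ (fun _ => b)
  change _ * partitionFunction β J Λ (fun _ => b) ≤ _ at hmain
  rw [integral_spec]
  calc (disorderLaw d r).real {ω | (cluster (thin J ω) x).Infinite}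
      ≤ (disorderLaw d r).real {ω | ConnectedToCompl Λ x (U.filter fun e => ω e = true)} := by
        refine measureReal_mono (fun ω hω => ?_) (measure_ne_top _ _)
        refine connectedToCompl_of_cluster_infinite (fun e he hJ => ?_) hω
        simp only [thin, Bool.and_eq_true] at hJ
        exact Finset.mem_filter.2 ⟨Finset.mem_filter.2 ⟨he, hJ.1⟩, hJ.2⟩
    _ ≤ (∑ ζ, φ ζ * Real.exp (-β * hamiltonian Λ J (glue Λ (fun _ => b) ζ))) /
          partitionFunction β J Λ (fun _ => b) := (le_div_iff₀ hZ).2 hmain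
    _ = _ := by
        rw [Finset.sum_div]
        exact Finset.sum_congr rfl fun ζ _ => by ring

/-! ### Distinct Gibbs measures -/

theorem cluster_infinite_le_integral_weakLimit {d q : ℕ} {β : ℝ} {r : unitInterval}
    (hβ : (r : ℝ) * (q * disagreementWeight q β) ≤ (1 - r) * (1 - disagreementWeight q β))
    (hδ : disagreementWeight q β ≤ 1)
    (J : Disorder d) (x : Site d) {a b : Spin q} (hab : a ≠ b)
    {ν : ProbabilityMeasure (Config d q)} (hν : ν ∈ weakLimits β J b) :
    (disorderLaw d r).real {ω | (cluster (thin J ω) x).Infinite} ≤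
      ∫ σ, ((if σ x = b then 1 else 0) - (if σ x = a then 1 else 0))
        ∂(ν : Measure (Config d q)) := by
  obtain ⟨k, -, hk⟩ := hν
  have hcont : Continuous fun σ : Config d q =>
      ((if σ x = b then 1 else 0) - (if σ x = a then 1 else 0) : ℝ) :=
    continuous_of_dependsOn (Set.finite_singleton x) fun σ τ h => by
      simp only [h x (Set.mem_singleton x)]
  exact ge_of_tendsto' (tendsto_integral_of_continuous hk hcont) fun n =>
    cluster_infinite_le_integral_spec hβ hδ J _ x hab

/-- For a common limit, the difference of the probabilities of `b` and `a` at `x` and its negative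
would both be bounded below by the same positive number. -/
theorem disjoint_weakLimits {d q : ℕ} {β : ℝ} {r : unitInterval}
    (hβ : (r : ℝ) * (q * disagreementWeight q β) ≤ (1 - r) * (1 - disagreementWeight q β))
    (hδ : disagreementWeight q β ≤ 1) {J : Disorder d} {x : Site d}
    (hx : disorderLaw d r {ω | (cluster (thin J ω) x).Infinite} ≠ 0) {a b : Spin q}
    (hab : a ≠ b) : Disjoint (weakLimits β J a) (weakLimits β J b) := by
  refine Set.disjoint_left.2 fun ν ha hb => ?_
  have h1 := cluster_infinite_le_integral_weakLimit hβ hδ J x hab hb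
  have h2 := cluster_infinite_le_integral_weakLimit hβ hδ J x hab.symm ha
  have hneg : ∫ σ, ((if σ x = a then 1 else 0) - (if σ x = b then 1 else 0) : ℝ)
        ∂(ν : Measure (Config d q)) =
      -∫ σ, ((if σ x = b then 1 else 0) - (if σ x = a then 1 else 0) : ℝ)
        ∂(ν : Measure (Config d q)) := by
    rw [← integral_neg]
    exact integral_congr_ae (ae_of_all _ fun σ => (neg_sub _ _).symm)
  have hpos : 0 < (disorderLaw d r).real {ω | (cluster (thin J ω) x).Infinite} :=
    ENNReal.toReal_pos hx (measure_ne_top _ _)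
  linarith

theorem le_encard_gibbsMeasures {d q : ℕ} {β : ℝ} {J : Disorder d}
    (h : ∀ a b : Spin q, a ≠ b → Disjoint (weakLimits β J a) (weakLimits β J b)) :
    (q : ℕ∞) ≤ (gibbsMeasures q β J).encard := by
  choose ν hν using fun b : Spin q => weakLimits_nonempty β J b
  have hinj : Function.Injective ν := fun a b hab => by
    by_contra hne
    exact Set.disjoint_left.1 (h a b hne) (hν a) (hab ▸ hν b)
  calc (q : ℕ∞) = (Set.range ν).encard := by
        rw [← Set.image_univ, hinj.encard_image, Set.encard_univ]; simp
    _ ≤ _ := Set.encard_le_encard <| Set.range_subset_iff.2 fun b =>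
        weakLimits_subset_gibbsMeasures β J b (hν b)

/-- The weight bounds needed for the percolation comparison hold at low temperature. -/
theorem exists_disagreementWeight_bounds (q : ℕ) {r : ℝ} (hr : r < 1) :
    ∃ β₀ : ℝ, 0 < β₀ ∧ ∀ β, β₀ < β →
      r * (q * disagreementWeight q β) ≤ (1 - r) * (1 - disagreementWeight q β) ∧
        disagreementWeight q β ≤ 1 := by
  have h := tendsto_disagreementWeight q
  have h1 : Tendsto (fun β => r * (q * disagreementWeight q β)) atTop (𝓝 (r * (q * 0))) :=
    (h.const_mul _).const_mul _
  have h2 : Tendsto (fun β => (1 - r) * (1 - disagreementWeight q β)) atTop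
      (𝓝 ((1 - r) * (1 - 0))) := (h.const_sub _).const_mul _
  -- As the disagreement weight tends to 0, the two sides tend to 0 and `1 - r > 0`.
  have hev := (h1.eventually_lt h2 (by simpa using hr)).and (h.eventually_lt_const one_pos)
  obtain ⟨β₀, hβ₀⟩ := eventually_atTop.1 hev
  exact ⟨max β₀ 1, by positivity, fun β hβ =>
    ⟨(hβ₀ β ((le_max_left _ _).trans hβ.le)).1.le, (hβ₀ β ((le_max_left _ _).trans hβ.le)).2.le⟩⟩

end DiluteClock

end

theorem theorem1 (d q : ℕ) (hd : 2 ≤ d) (hq : 2 ≤ q) (p : unitInterval)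
    (hp : DiluteClock.criticalProb d < (p : ℝ)) :
    ∃ β₀ : ℝ, 0 < β₀ ∧ ∀ β : ℝ, β₀ < β →
      ∀ᵐ J ∂(DiluteClock.disorderLaw d p),
        (q : ℕ∞) ≤ (DiluteClock.gibbsMeasures q β J).encard ∧
        (∀ b : DiluteClock.Spin q,
          (DiluteClock.weakLimits β J b).Nonempty ∧
          DiluteClock.weakLimits β J b ⊆ DiluteClock.gibbsMeasures q β J) ∧
        ∀ a b : DiluteClock.Spin q, a ≠ b →
          Disjoint (DiluteClock.weakLimits β J a) (DiluteClock.weakLimits β J b) := by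
  obtain ⟨r, hr, hae⟩ := DiluteClock.exists_thinning_ae_percolates hp
  obtain ⟨β₀, hβ₀, hbounds⟩ := DiluteClock.exists_disagreementWeight_bounds q hr
  refine ⟨β₀, hβ₀, fun β hβ => ?_⟩
  filter_upwards [hae] with J ⟨x, hx⟩
  have hdisj : ∀ a b : DiluteClock.Spin q, a ≠ b →
      Disjoint (DiluteClock.weakLimits β J a) (DiluteClock.weakLimits β J b) := fun a b hab =>
    DiluteClock.disjoint_weakLimits (hbounds β hβ).1 (hbounds β hβ).2 hx hab
  exact ⟨DiluteClock.le_encard_gibbsMeasures hdisj,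
    fun b => ⟨DiluteClock.weakLimits_nonempty β J b,
      DiluteClock.weakLimits_subset_gibbsMeasures β J b⟩, hdisj⟩
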